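/- Convergence of AdaGrad-norm SGD for convex smooth objectives, with affine-variance noise. Let $f:\mathbb{R}^d\to\mathbb{R}$ be convex and $\beta$-smooth (differentiable, with $\|\nabla f(x)-\nabla f(y)\|\le\beta\|x-y\|$ for all $x,y$, where $\beta\ge 0$ and $\|\cdot\|$ is the Euclidean norm), and suppose that $f$ attains its minimum $f^\star$ at a point $w^\star$. Let $\sigma_0,\sigma_1\ge 0$, and let $g$ be a stochastic gradient oracle: for every $w\in\mathbb{R}^d$ it returns a random vector $g(w)$ with $\mathbb{E}[g(w)]=\nabla f(w)$ and, with probability one, $\|g(w)-\nabla f(w)\|^2\le\sigma_0^2+\sigma_1^2\|\nabla f(w)\|^2$. For $\eta,\gamma>0$, $T\ge 1$ and a starting point $w_1\in\mathbb{R}^d$, AdaGrad-norm SGD performs, for $t=1,\dots,T$, $$w_{t+1}=w_t-\eta_t g_t,\qquad \eta_t=\frac{\eta}{\sqrt{\gamma^2+\sum_{s=1}^t\|g_s\|^2}},$$ where, given $g_1,\dots,g_{t-1}$, the vector $g_t$ is distributed as $g(w_t)$. Write $d_1=\|w_1-w^\star\|$, $\Delta_1=f(w_1)-f^\star$, let $\log$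 be the logarithm to base $2$, and for $\delta\in(0,1/4)$ put $$\Lambda=\log\Bigl(2+\frac{T}{\delta}+\frac{\sigma_0}{\gamma}+\sigma_1+\frac{\eta\beta}{\gamma}+\frac{\beta\Delta_1}{\gamma^2}\Bigr).$$ There are a universal constant $c>0$ and a universal exponent $p\in\mathbb{N}$ (not depending on $d$, $f$, the oracle or any of the parameters) such that, with $$F=c\,\Lambda^p\bigl(\Delta_1+\eta\sigma_0+\eta^2\beta\sigma_1^2+\eta^2\beta\bigr),$$ $$D^2=c\,\Lambda^p\Bigl(d_1^2+\eta^2\bigl(1+\sigma_1^2+\gamma^{-2}(\sigma_0^2+\beta\sigma_1^2F)+\gamma^{-4}(\sigma_0^4+\beta^2\sigma_1^4F^2)\bigr)\Bigr),\qquad D\ge 0,$$ for every $\delta\in(0,1/4)$ the following two statements hold simultaneously with probability at least $1-\delta$: (i) $$f\Bigl(\frac1T\sum_{t=1}^Tw_t\Bigr)-f^\star\le c\Bigl(\frac{D^2}{\eta}+\eta+D\sqrt{\log\tfrac1\delta}\Bigr)\frac{\sigma_0}{\sqrt T}+c\Bigl(\frac{\gamma d_1^2}{\eta}+\beta(1+\sigma_1^2)\Bigl(\frac{D^2}{\eta}+\eta\Bigr)^2+\beta\sigma_1^2D^2\log\tfrac1\delta\Bigr)\frac1T;$$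 (ii) $\|w_t-w^\star\|\le D$ for all $1\le t\le T+1$. -/

import Mathlib

open MeasureTheory ProbabilityTheory
open scoped Gradient

noncomputable section

namespace AdaGradNorm

/-- `f : ℝᵈ → ℝ` is `β`-smooth: it is differentiable and its gradient is `β`-Lipschitz for the
Euclidean norm. -/
def IsSmoothWith {d : ℕ} (β : ℝ) (f : EuclideanSpace ℝ (Fin d) → ℝ) : Prop :=
  Differentiable ℝ f ∧ ∀ x y, ‖∇ f x - ∇ f y‖ ≤ β * ‖x - y‖

/-- A stochastic first-order oracle for `f` is a Markov kernel `κ` on `ℝᵈ`: `κ w` is the law of the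
random vector `g(w)` returned at the query point `w`. It is an unbiased oracle with bounded
affine-variance noise of parameters `σ₀, σ₁` if `𝔼[g(w)] = ∇f(w)` and, with probability one,
`‖g(w) - ∇f(w)‖² ≤ σ₀² + σ₁² ‖∇f(w)‖²`, for every `w`. -/
structure IsAffineNoiseOracle {d : ℕ} (f : EuclideanSpace ℝ (Fin d) → ℝ) (σ₀ σ₁ : ℝ)
    (κ : Kernel (EuclideanSpace ℝ (Fin d)) (EuclideanSpace ℝ (Fin d))) : Prop where
  markov : IsMarkovKernel κ
  unbiased : ∀ w, ∫ v, v ∂(κ w) = ∇ f w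
  noise : ∀ w, ∀ᵐ v ∂(κ w), ‖v - ∇ f w‖ ^ 2 ≤ σ₀ ^ 2 + σ₁ ^ 2 * ‖∇ f w‖ ^ 2

/-- The AdaGrad-norm step size. Time is counted from `0`, so `g 0, …, g t` are the first `t + 1`
stochastic gradients and `stepSize η γ g t` is the step size of the `(t + 1)`-st step. -/
def stepSize {d : ℕ} (η γ : ℝ) (g : ℕ → EuclideanSpace ℝ (Fin d)) (t : ℕ) : ℝ :=
  η / √(γ ^ 2 + ∑ s ∈ Finset.range (t + 1), ‖g s‖ ^ 2)

/-- The AdaGrad-norm iterates computed from the starting point `w₁` and the observed stochastic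
gradients. Time is counted from `0`: `iterate η γ w₁ g t` is the iterate usually written
`w_{t+1}`. It depends on `g 0, …, g (t - 1)` only. -/
def iterate {d : ℕ} (η γ : ℝ) (w₁ : EuclideanSpace ℝ (Fin d))
    (g : ℕ → EuclideanSpace ℝ (Fin d)) : ℕ → EuclideanSpace ℝ (Fin d)
  | 0 => w₁
  | t + 1 => iterate η γ w₁ g t - stepSize η γ g t • g t

/-- The random vectors `g 0, …, g (T - 1)` on the probability space `(Ω, P)` are the stochastic
gradients of a `T`-step run of AdaGrad-norm SGD with oracle `κ` started at `w₁`: given all the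
previous stochastic gradients, `g t` is drawn from the oracle queried at the current iterate. -/
structure IsRun {d : ℕ} {Ω : Type*} [MeasurableSpace Ω] (P : Measure Ω) [IsFiniteMeasure P]
    (κ : Kernel (EuclideanSpace ℝ (Fin d)) (EuclideanSpace ℝ (Fin d)))
    (η γ : ℝ) (w₁ : EuclideanSpace ℝ (Fin d)) (T : ℕ)
    (g : ℕ → Ω → EuclideanSpace ℝ (Fin d)) : Prop where
  measurable : ∀ t < T, Measurable (g t)
  law : ∀ t < T, ∀ᵐ ω ∂P,
    condDistrib (g t) (fun ω' (s : Fin t) => g s ω') P (fun s : Fin t => g s ω) =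
      κ (iterate η γ w₁ (fun s => g s ω) t)

/-- The logarithmic factor (base `2`) whose powers are hidden by the notation `Õ`. It is at least
`1`, and involves the horizon, the failure probability and scale-free ratios of the parameters;
`Δ₁` stands for the initial gap `f w₁ - f⋆`. -/
def logFactor (T : ℕ) (δ β σ₀ σ₁ η γ Δ₁ : ℝ) : ℝ :=
  Real.logb 2 (2 + T / δ + σ₀ / γ + σ₁ + η * β / γ + β * Δ₁ / γ ^ 2)

/-- `F = Õ(Δ₁ + η σ₀ + η² β σ₁² + η² β)`, with constant `c` and log factor `L ^ p`. -/
def gapBound (c : ℝ) (p : ℕ) (L β σ₀ σ₁ η Δ₁ : ℝ) : ℝ :=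
  c * L ^ p * (Δ₁ + η * σ₀ + η ^ 2 * β * σ₁ ^ 2 + η ^ 2 * β)

/-- `D² = Õ(d₁² + η² (1 + σ₁² + γ⁻² (σ₀² + β σ₁² F) + γ⁻⁴ (σ₀⁴ + β² σ₁⁴ F²)))`, with constant `c`
and log factor `L ^ p`. -/
def sqDistBound (c : ℝ) (p : ℕ) (L β σ₀ σ₁ η γ d₁ F : ℝ) : ℝ :=
  c * L ^ p * (d₁ ^ 2 + η ^ 2 * (1 + σ₁ ^ 2 + (σ₀ ^ 2 + β * σ₁ ^ 2 * F) / γ ^ 2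
    + (σ₀ ^ 4 + β ^ 2 * σ₁ ^ 4 * F ^ 2) / γ ^ 4))

end AdaGradNorm

end

/-!
The proof is pathwise on a good event. Along a run, the current iterate and the accumulator
`sqSum γ g t = γ² + ∑_{s < t} ‖g s‖²` form the state of a Markov process, so any function
`φ (w, S, v)` with `𝔼 exp φ ≤ 1` under the oracle in every state gives an exponential
supermartingale (`IsRun.lintegral_exp_sum_le`). By the Chernoff bound and a union bound over time,
its logarithm exceeds `log (8 T / δ)` at some time with probability at most `δ / 4`
(`IsRun.measure_sum_gt_le`). Four such functions are used, and in each of them the true step size,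
which depends on the current stochastic gradient, is replaced by a decorrelated one.

* `gapInc` controls the function values. The step size `η / √(S + s² + ‖∇f(w)‖²)`, with `s` the
  noise level at `w`, makes both the compensator (by Hoeffding's lemma) and the decorrelation error
  absorbable by the drift, up to multiples of `‖g_t‖² / sqSum (t + 1)`, which sum to a logarithm.
  Induction on time then gives `f (w_t) - f⋆ ≤ F` (`gap_le_of_sum_gapInc_le`): while the gap is at
  most `F`, the noise level is at most `σ₀ + σ₁ √(4 β F)`, and the dependence on `√F` is absorbed by
  Young's inequality.
* `distInc` and `noiseInc` control the distance to the minimizer. With the step size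
  `η / √(S + ‖∇f(w)‖²)` the drift is nonpositive by convexity. The compensator is expressed through
  the observed `‖g_t‖²`, using `𝔼 ‖v - 𝔼 v‖² ≤ 𝔼 ‖v‖²`; this is what leaves only logarithms, at the
  price of the ratio of noise level to `γ`. Induction on time gives `‖w_t - w⋆‖ ≤ D`
  (`norm_iterate_sub_le_of_sum_le`).
* `regretInc` controls the noise in the regret. Its exponential parameter is tuned so that the part
  of the noise proportional to the gap is absorbed by the regret, and the accumulator is in turn
  bounded by the regret (`sum_gap_le_of_sum_regretInc_le`). Jensen's inequality finishes the proof.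

Since `D² ≥ (L η)²`, with `L` the logarithmic factor, all logarithms that appear in the last step
are absorbed by `D² / η`.
-/

open MeasureTheory ProbabilityTheory
open scoped Gradient

namespace AdaGradNorm

/-! ### Convex smooth functions -/

section Convex

variable {d : ℕ} {f : EuclideanSpace ℝ (Fin d) → ℝ} {β : ℝ}

lemma add_inner_gradient_le (hf : ConvexOn ℝ Set.univ f) (hd : Differentiable ℝ f)
    (x y : EuclideanSpace ℝ (Fin d)) : f x + inner ℝ (∇ f x) (y - x) ≤ f y := by
  have hconv : ConvexOn ℝ Set.univ (fun t : ℝ => f (AffineMap.lineMap x y t)) := by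
    have h := hf.comp_affineMap (AffineMap.lineMap x y : ℝ →ᵃ[ℝ] EuclideanSpace ℝ (Fin d))
    rwa [Set.preimage_univ] at h
  have hderiv : HasDerivAt (fun t : ℝ => f (AffineMap.lineMap x y t))
      (inner ℝ (∇ f x) (y - x)) 0 := by
    have h1 : HasDerivAt (fun t : ℝ => (AffineMap.lineMap x y t : EuclideanSpace ℝ (Fin d)))
        (y - x) 0 := AffineMap.hasDerivAt_lineMap
    have h2 : HasFDerivAt f (InnerProductSpace.toDual ℝ _ (∇ f x))
        (AffineMap.lineMap x y (0 : ℝ)) := by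
      simpa using (hd x).hasGradientAt.hasFDerivAt
    exact h2.comp_hasDerivAt (0 : ℝ) h1
  have h := hconv.le_slope_of_hasDerivAt (Set.mem_univ 0) (Set.mem_univ 1) one_pos hderiv
  simp only [slope_def_field, AffineMap.lineMap_apply_one, AffineMap.lineMap_apply_zero, sub_zero,
    div_one] at h
  linarith

/-- The descent inequality of a convex `β`-smooth function. Convexity gives it at once, with `β`
in place of the sharp constant `β / 2`. -/
lemma le_add_inner_gradient_add (hf : ConvexOn ℝ Set.univ f) (hs : IsSmoothWith β f)
    (x y : EuclideanSpace ℝ (Fin d)) :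
    f y ≤ f x + inner ℝ (∇ f x) (y - x) + β * ‖y - x‖ ^ 2 := by
  have h1 := add_inner_gradient_le hf hs.1 y x
  have h2 : inner ℝ (∇ f y - ∇ f x) (y - x) ≤ β * ‖y - x‖ * ‖y - x‖ :=
    (real_inner_le_norm _ _).trans
      (mul_le_mul_of_nonneg_right (hs.2 y x) (norm_nonneg _))
  rw [inner_sub_left] at h2
  have h3 : inner ℝ (∇ f y) (x - y) = -inner ℝ (∇ f y) (y - x) := by
    rw [← inner_neg_right, neg_sub]
  nlinarith

lemma gradient_eq_zero_of_forall_le {w : EuclideanSpace ℝ (Fin d)} (hmin : ∀ x, f w ≤ f x) :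
    ∇ f w = 0 := by
  have h : IsLocalMin f w := Filter.Eventually.of_forall hmin
  simp [gradient, h.fderiv_eq_zero]

/-- The gradient of a convex smooth function is controlled by the optimality gap (again with twice
the sharp constant). -/
lemma norm_gradient_sq_le (hβ : 0 ≤ β) (hf : ConvexOn ℝ Set.univ f) (hs : IsSmoothWith β f)
    {w : EuclideanSpace ℝ (Fin d)} (hmin : ∀ x, f w ≤ f x) (x : EuclideanSpace ℝ (Fin d)) :
    ‖∇ f x‖ ^ 2 ≤ 4 * β * (f x - f w) := by
  rcases hβ.eq_or_lt with rfl | hβ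
  · have h := hs.2 x w
    rw [gradient_eq_zero_of_forall_le hmin] at h
    have : ‖∇ f x‖ = 0 := le_antisymm (by simpa using h) (norm_nonneg _)
    simp [this]
  -- a gradient step of length `1 / (2 * β)` cannot go below the minimum
  · have h := le_add_inner_gradient_add hf hs x (x - (1 / (2 * β)) • ∇ f x)
    have h2 := hmin (x - (1 / (2 * β)) • ∇ f x)
    rw [sub_sub_cancel_left, inner_neg_right, inner_smul_right, real_inner_self_eq_norm_sq,
      norm_neg, norm_smul, mul_pow, Real.norm_eq_abs, sq_abs] at h
    have h3 : β * ((1 / (2 * β)) ^ 2 * ‖∇ f x‖ ^ 2) = ‖∇ f x‖ ^ 2 / (4 * β) := by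
      field_simp; ring
    have h4 : 1 / (2 * β) * ‖∇ f x‖ ^ 2 = 2 * (‖∇ f x‖ ^ 2 / (4 * β)) := by
      field_simp; ring
    have h5 : ‖∇ f x‖ ^ 2 / (4 * β) ≤ f x - f w := by linarith
    rwa [div_le_iff₀ (by positivity), mul_comm] at h5

lemma IsSmoothWith.continuous_gradient (hs : IsSmoothWith β f) : Continuous (∇ f) := by
  refine (LipschitzWith.of_dist_le_mul (K := β.toNNReal) fun x y => ?_).continuous
  rw [dist_eq_norm, dist_eq_norm]
  exact (hs.2 x y).trans (mul_le_mul_of_nonneg_right (Real.le_coe_toNNReal β) (norm_nonneg _))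

end Convex

/-! ### The iterates as functions of the stochastic gradients -/

section State

variable {d : ℕ} {η γ : ℝ} {w₁ : EuclideanSpace ℝ (Fin d)}

/-- The accumulator `γ² + ∑_{s < t} ‖g s‖²` of AdaGrad-norm before the `(t + 1)`-st step: the state
of the algorithm is the current iterate together with this number. -/
noncomputable def sqSum (γ : ℝ) (g : ℕ → EuclideanSpace ℝ (Fin d)) (t : ℕ) : ℝ :=
  γ ^ 2 + ∑ s ∈ Finset.range t, ‖g s‖ ^ 2

lemma sqSum_succ (γ : ℝ) (g : ℕ → EuclideanSpace ℝ (Fin d)) (t : ℕ) :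
    sqSum γ g (t + 1) = sqSum γ g t + ‖g t‖ ^ 2 := by
  simp [sqSum, Finset.sum_range_succ, add_assoc]

lemma stepSize_eq (η γ : ℝ) (g : ℕ → EuclideanSpace ℝ (Fin d)) (t : ℕ) :
    stepSize η γ g t = η / √(sqSum γ g (t + 1)) := rfl

lemma sq_le_sqSum (γ : ℝ) (g : ℕ → EuclideanSpace ℝ (Fin d)) (t : ℕ) : γ ^ 2 ≤ sqSum γ g t :=
  le_add_of_nonneg_right (Finset.sum_nonneg fun _ _ => sq_nonneg _)

lemma sqSum_congr {g g' : ℕ → EuclideanSpace ℝ (Fin d)} {t : ℕ} (h : ∀ s < t, g s = g' s) :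
    sqSum γ g t = sqSum γ g' t := by
  unfold sqSum
  rw [Finset.sum_congr rfl fun s hs => by rw [h s (Finset.mem_range.1 hs)]]

lemma iterate_congr {g g' : ℕ → EuclideanSpace ℝ (Fin d)} {t : ℕ} (h : ∀ s < t, g s = g' s) :
    iterate η γ w₁ g t = iterate η γ w₁ g' t := by
  induction t with
  | zero => rfl
  | succ t ih =>
    simp only [iterate, stepSize_eq]
    rw [ih fun s hs => h s (hs.trans t.lt_succ_self), sqSum_congr h, h t t.lt_succ_self]

lemma measurable_sqSum (γ : ℝ) (t : ℕ) :
    Measurable fun g : ℕ → EuclideanSpace ℝ (Fin d) => sqSum γ g t := by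
  unfold sqSum
  fun_prop

lemma measurable_iterate (η γ : ℝ) (w₁ : EuclideanSpace ℝ (Fin d)) (t : ℕ) :
    Measurable fun g : ℕ → EuclideanSpace ℝ (Fin d) => iterate η γ w₁ g t := by
  induction t with
  | zero => exact measurable_const
  | succ t ih =>
    have h := measurable_sqSum (d := d) γ (t + 1)
    simp only [iterate, stepSize_eq]
    fun_prop

/-- A finite history of stochastic gradients, continued by zeros. -/
def extendZero {t : ℕ} (h : Fin t → EuclideanSpace ℝ (Fin d)) (s : ℕ) : EuclideanSpace ℝ (Fin d) :=
  if hs : s < t then h ⟨s, hs⟩ else 0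

lemma extendZero_of_lt {t s : ℕ} (hs : s < t) (g : ℕ → EuclideanSpace ℝ (Fin d)) :
    extendZero (fun i : Fin t => g i) s = g s := by
  simp [extendZero, hs]

lemma measurable_extendZero (t : ℕ) :
    Measurable (extendZero : (Fin t → EuclideanSpace ℝ (Fin d)) → _) := by
  refine measurable_pi_lambda _ fun s => ?_
  by_cases hs : s < t
  · simp only [extendZero, hs, dite_true]; fun_prop
  · simp only [extendZero, hs, dite_false]; fun_prop

end State

/-! ### Concentration along a run -/

section Run

variable {d : ℕ} {Ω : Type*} [MeasurableSpace Ω] {P : Measure Ω} [IsProbabilityMeasure P]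
  {κ : Kernel (EuclideanSpace ℝ (Fin d)) (EuclideanSpace ℝ (Fin d))}
  {η γ : ℝ} {w₁ : EuclideanSpace ℝ (Fin d)} {T : ℕ} {g : ℕ → Ω → EuclideanSpace ℝ (Fin d)}

/-- Disintegration along a run: given the history, `g t` is integrated against the oracle. -/
lemma IsRun.lintegral_eq [IsMarkovKernel κ] (hrun : IsRun P κ η γ w₁ T g) {t : ℕ} (ht : t < T)
    {Ψ : (Fin t → EuclideanSpace ℝ (Fin d)) × EuclideanSpace ℝ (Fin d) → ENNReal}
    (hΨ : Measurable Ψ) :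
    ∫⁻ ω, Ψ (fun s => g s ω, g t ω) ∂P =
      ∫⁻ ω, ∫⁻ v, Ψ (fun s => g s ω, v) ∂κ (iterate η γ w₁ (fun s => g s ω) t) ∂P := by
  have hX : Measurable fun ω (s : Fin t) => g s ω :=
    measurable_pi_lambda _ fun s => hrun.measurable s (s.2.trans ht)
  have hY := hrun.measurable t ht
  rw [← lintegral_map (f := Ψ) hΨ (hX.prodMk hY), ← compProd_map_condDistrib hY.aemeasurable,
    Measure.lintegral_compProd hΨ,
    lintegral_map (hΨ.lintegral_kernel_prod_right' (κ := condDistrib (g t) _ P)) hX]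
  refine lintegral_congr_ae ?_
  filter_upwards [hrun.law t ht] with ω hω
  rw [hω]

lemma IsRun.measurable_of_congr {α : Type*} [MeasurableSpace α] (hrun : IsRun P κ η γ w₁ T g)
    {t : ℕ} (ht : t ≤ T) {F : (ℕ → EuclideanSpace ℝ (Fin d)) → α} (hF : Measurable F)
    (hc : ∀ x y, (∀ s < t, x s = y s) → F x = F y) :
    Measurable fun ω => F fun s => g s ω := by
  have hX : Measurable fun ω (s : Fin t) => g s ω :=
    measurable_pi_lambda _ fun s => hrun.measurable s (s.2.trans_le ht)
  convert hF.comp ((measurable_extendZero t).comp hX) using 1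
  exact funext fun ω => hc _ _ fun s hs => (extendZero_of_lt hs fun i => g i ω).symm

/-- Almost sure properties of the oracle hold almost surely along a run. -/
lemma IsRun.ae_of_oracle [IsMarkovKernel κ] (hrun : IsRun P κ η γ w₁ T g)
    {p : EuclideanSpace ℝ (Fin d) → EuclideanSpace ℝ (Fin d) → Prop}
    (hp : MeasurableSet {q : EuclideanSpace ℝ (Fin d) × EuclideanSpace ℝ (Fin d) | p q.1 q.2})
    (hκ : ∀ w, ∀ᵐ v ∂κ w, p w v) {t : ℕ} (ht : t < T) :
    ∀ᵐ ω ∂P, p (iterate η γ w₁ (fun s => g s ω) t) (g t ω) := by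
  have hit : ∀ x : ℕ → EuclideanSpace ℝ (Fin d),
      iterate η γ w₁ (extendZero fun s : Fin t => x s) t = iterate η γ w₁ x t := fun x =>
    iterate_congr fun s hs => extendZero_of_lt hs x
  have hit' : ∀ ω, iterate η γ w₁ (extendZero fun s : Fin t => g s ω) t =
      iterate η γ w₁ (fun s => g s ω) t := fun ω => hit fun s => g s ω
  let Φ : EuclideanSpace ℝ (Fin d) × EuclideanSpace ℝ (Fin d) → ENNReal :=
    Set.indicator {q | ¬ p q.1 q.2} 1
  have hΦ : Measurable Φ := measurable_one.indicator hp.compl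
  have hm : Measurable fun q : (Fin t → EuclideanSpace ℝ (Fin d)) × EuclideanSpace ℝ (Fin d) =>
      (iterate η γ w₁ (extendZero q.1) t, q.2) :=
    (((measurable_iterate η γ w₁ t).comp (measurable_extendZero t)).comp
      measurable_fst).prodMk measurable_snd
  have h := hrun.lintegral_eq ht (hΦ.comp hm)
  simp only [Function.comp_def] at h
  have h0 : ∫⁻ ω, Φ (iterate η γ w₁ (fun s => g s ω) t, g t ω) ∂P = 0 := by
    simp only [hit'] at h
    rw [h, lintegral_eq_zero_of_ae_eq_zero]
    refine Filter.Eventually.of_forall fun ω => ?_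
    refine lintegral_eq_zero_of_ae_eq_zero ?_
    filter_upwards [hκ (iterate η γ w₁ (fun s => g s ω) t)] with v hv
    simp [Φ, hv]
  have hgm : Measurable fun ω => (iterate η γ w₁ (fun s => g s ω) t, g t ω) := by
    exact (hrun.measurable_of_congr ht.le (measurable_iterate η γ w₁ t)
      fun x y => iterate_congr).prodMk (hrun.measurable t ht)
  have h0 := (lintegral_eq_zero_iff (hΦ.comp hgm)).1 h0
  filter_upwards [h0] with ω hω
  by_contra hn
  simp [Φ, hn] at hω

/-- The exponential supermartingale bound: if `exp (φ w S v)` has mean at most `1` under the oracle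
in every state `(w, S)`, then so has the exponential of the sum of `φ` along a run. -/
lemma IsRun.lintegral_exp_sum_le [IsMarkovKernel κ] (hrun : IsRun P κ η γ w₁ T g)
    {φ : EuclideanSpace ℝ (Fin d) → ℝ → EuclideanSpace ℝ (Fin d) → ℝ}
    (hφ : Measurable fun q : EuclideanSpace ℝ (Fin d) × ℝ × EuclideanSpace ℝ (Fin d) =>
      φ q.1 q.2.1 q.2.2)
    (hle : ∀ w S, γ ^ 2 ≤ S → ∫⁻ v, ENNReal.ofReal (Real.exp (φ w S v)) ∂κ w ≤ 1)
    {n : ℕ} (hn : n ≤ T) :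
    ∫⁻ ω, ENNReal.ofReal (Real.exp (∑ t ∈ Finset.range n,
      φ (iterate η γ w₁ (fun s => g s ω) t) (sqSum γ (fun s => g s ω) t) (g t ω))) ∂P ≤ 1 := by
  induction n with
  | zero => simp
  | succ n ih =>
    let Φ : (ℕ → EuclideanSpace ℝ (Fin d)) → ℕ → EuclideanSpace ℝ (Fin d) → ℝ := fun x t v =>
      φ (iterate η γ w₁ x t) (sqSum γ x t) v
    have hΦ : ∀ t, Measurable fun q : (ℕ → EuclideanSpace ℝ (Fin d)) × EuclideanSpace ℝ (Fin d) =>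
        Φ q.1 t q.2 := fun t =>
      hφ.comp (((measurable_iterate η γ w₁ t).comp measurable_fst).prodMk
        (((measurable_sqSum γ t).comp measurable_fst).prodMk measurable_snd))
    have hext : ∀ (x : ℕ → EuclideanSpace ℝ (Fin d)) (t : ℕ), t ≤ n → ∀ v,
        Φ (extendZero fun s : Fin n => x s) t v = Φ x t v := fun x t ht v => by
      have hc : ∀ s < t, extendZero (fun s : Fin n => x s) s = x s := fun s hs =>
        extendZero_of_lt (hs.trans_le ht) x
      simp only [Φ, iterate_congr hc, sqSum_congr hc]
    let Ψ : (Fin n → EuclideanSpace ℝ (Fin d)) × EuclideanSpace ℝ (Fin d) → ENNReal := fun q =>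
      ENNReal.ofReal (Real.exp (∑ t ∈ Finset.range n,
        Φ (extendZero q.1) t (extendZero q.1 t))) *
      ENNReal.ofReal (Real.exp (Φ (extendZero q.1) n q.2))
    have hE : Measurable fun q : (Fin n → EuclideanSpace ℝ (Fin d)) × EuclideanSpace ℝ (Fin d) =>
        extendZero q.1 := (measurable_extendZero n).comp measurable_fst
    have hΨ : Measurable Ψ := by
      refine Measurable.mul (M := ENNReal) ?_ ?_
      · refine (Real.measurable_exp.comp (Finset.measurable_sum _ fun t _ => ?_)).ennreal_ofReal
        exact (hΦ t).comp (hE.prodMk ((measurable_pi_apply t).comp hE))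
      · exact (Real.measurable_exp.comp ((hΦ n).comp (hE.prodMk measurable_snd))).ennreal_ofReal
    have hsum : ∀ x : ℕ → EuclideanSpace ℝ (Fin d),
        ∑ t ∈ Finset.range n, Φ (extendZero fun s : Fin n => x s) t
          (extendZero (fun s : Fin n => x s) t) = ∑ t ∈ Finset.range n, Φ x t (x t) := fun x =>
      Finset.sum_congr rfl fun t ht => by
        rw [extendZero_of_lt (Finset.mem_range.1 ht), hext x t (Finset.mem_range.1 ht).le]
    have h1 : ∀ ω, ENNReal.ofReal (Real.exp (∑ t ∈ Finset.range (n + 1),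
        Φ (fun s => g s ω) t (g t ω))) = Ψ (fun s => g s ω, g n ω) := fun ω => by
      simp only [Ψ]
      rw [hsum (fun s => g s ω), hext (fun s => g s ω) n le_rfl, Finset.sum_range_succ,
        Real.exp_add, ENNReal.ofReal_mul (Real.exp_pos _).le]
    change ∫⁻ ω, ENNReal.ofReal (Real.exp (∑ t ∈ Finset.range (n + 1),
        Φ (fun s => g s ω) t (g t ω))) ∂P ≤ 1
    simp only [h1]
    rw [hrun.lintegral_eq hn hΨ]
    refine le_trans (lintegral_mono fun ω => ?_) (ih (Nat.le_of_succ_le hn))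
    simp only [Ψ]
    rw [hsum (fun s => g s ω), lintegral_const_mul' _ _ ENNReal.ofReal_ne_top]
    simp only [hext (fun s => g s ω) n le_rfl]
    exact mul_le_of_le_one_right' (hle _ _ (sq_le_sqSum _ _ _))

/-- Chernoff bound for sums along a run, uniformly in the number of summands. -/
lemma IsRun.measure_sum_gt_le [IsMarkovKernel κ] (hrun : IsRun P κ η γ w₁ T g)
    {φ : EuclideanSpace ℝ (Fin d) → ℝ → EuclideanSpace ℝ (Fin d) → ℝ}
    (hφ : Measurable fun q : EuclideanSpace ℝ (Fin d) × ℝ × EuclideanSpace ℝ (Fin d) =>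
      φ q.1 q.2.1 q.2.2)
    (hle : ∀ w S, γ ^ 2 ≤ S → ∫⁻ v, ENNReal.ofReal (Real.exp (φ w S v)) ∂κ w ≤ 1)
    {δ : ℝ} (hδ : 0 < δ) (hT : 1 ≤ T) :
    P {ω | ∃ n ≤ T, Real.log (8 * T / δ) < ∑ t ∈ Finset.range n,
      φ (iterate η γ w₁ (fun s => g s ω) t) (sqSum γ (fun s => g s ω) t) (g t ω)} ≤
    ENNReal.ofReal (δ / 4) := by
  have hT' : (1 : ℝ) ≤ T := by exact_mod_cast hT
  have hone : ∀ n ≤ T, P {ω | Real.log (8 * T / δ) < ∑ t ∈ Finset.range n,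
      φ (iterate η γ w₁ (fun s => g s ω) t) (sqSum γ (fun s => g s ω) t) (g t ω)} ≤
      ENNReal.ofReal (δ / (8 * T)) := fun n hn => by
    have hpos : 0 < 8 * T / δ := by positivity
    have h1 := meas_le_lintegral₀ (μ := P) (s := {ω | Real.log (8 * T / δ) < ∑ t ∈ Finset.range n,
      φ (iterate η γ w₁ (fun s => g s ω) t) (sqSum γ (fun s => g s ω) t) (g t ω)})
      (f := fun ω => ENNReal.ofReal (δ / (8 * T)) * ENNReal.ofReal (Real.exp (∑ t ∈ Finset.range n,
      φ (iterate η γ w₁ (fun s => g s ω) t) (sqSum γ (fun s => g s ω) t) (g t ω)))) ?_ ?_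
    · refine h1.trans ?_
      rw [lintegral_const_mul' _ _ ENNReal.ofReal_ne_top]
      exact mul_le_of_le_one_right' (hrun.lintegral_exp_sum_le hφ hle hn)
    · refine (measurable_const.mul (Real.measurable_exp.comp (Finset.measurable_sum _
        fun t ht => ?_)).ennreal_ofReal).aemeasurable
      have ht := (Finset.mem_range.1 ht).trans_le hn
      exact hφ.comp ((hrun.measurable_of_congr ht.le (measurable_iterate η γ w₁ t)
        fun x y => iterate_congr).prodMk ((hrun.measurable_of_congr ht.le (measurable_sqSum γ t)
        fun x y => sqSum_congr).prodMk (hrun.measurable t ht)))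
    · intro ω hω
      have h2 := Real.exp_le_exp.2 (le_of_lt hω)
      rw [Real.exp_log hpos] at h2
      rw [← ENNReal.ofReal_mul (by positivity), ENNReal.one_le_ofReal]
      calc (1 : ℝ) = δ / (8 * T) * (8 * T / δ) := by field_simp
        _ ≤ _ := by gcongr
  have hsub : {ω | ∃ n ≤ T, Real.log (8 * T / δ) < ∑ t ∈ Finset.range n,
      φ (iterate η γ w₁ (fun s => g s ω) t) (sqSum γ (fun s => g s ω) t) (g t ω)} ⊆
      ⋃ n ∈ Finset.range (T + 1), {ω | Real.log (8 * T / δ) < ∑ t ∈ Finset.range n,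
      φ (iterate η γ w₁ (fun s => g s ω) t) (sqSum γ (fun s => g s ω) t) (g t ω)} := by
    rintro ω ⟨n, hn, h⟩
    simp only [Set.mem_iUnion, Finset.mem_range]
    exact ⟨n, Nat.lt_succ_of_le hn, h⟩
  refine (measure_mono hsub).trans ((measure_biUnion_finset_le _ _).trans ?_)
  refine (Finset.sum_le_sum fun n hn =>
    hone n (Nat.le_of_lt_succ (Finset.mem_range.1 hn))).trans ?_
  rw [Finset.sum_const, Finset.card_range, nsmul_eq_mul, ← ENNReal.ofReal_natCast,
    ← ENNReal.ofReal_mul (by positivity)]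
  refine ENNReal.ofReal_le_ofReal ?_
  push_cast
  calc ((T : ℝ) + 1) * (δ / (8 * T)) ≤ (2 * T) * (δ / (8 * T)) := by gcongr; linarith
    _ = δ / 4 := by field_simp; norm_num

end Run

/-! ### Exponential moments of one stochastic gradient -/

section OneStep

/-- Hoeffding's lemma, in the form in which it feeds an exponential supermartingale. -/
lemma lintegral_exp_sub_le_one_of_abs_le {α : Type*} [MeasurableSpace α] {μ : Measure α}
    [IsProbabilityMeasure μ] {X : α → ℝ} (hX : Measurable X) {c : ℝ} (hc : 0 ≤ c)
    (hbd : ∀ᵐ a ∂μ, |X a| ≤ c) (hint : ∫ a, X a ∂μ = 0) :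
    ∫⁻ a, ENNReal.ofReal (Real.exp (X a - c ^ 2 / 2)) ∂μ ≤ 1 := by
  have h := hasSubgaussianMGF_of_mem_Icc_of_integral_eq_zero (μ := μ) (a := -c) (b := c)
    hX.aemeasurable (by filter_upwards [hbd] with a ha using abs_le.1 ha) hint
  have h1 := h.mgf_le 1
  have h2 := h.integrable_exp_mul 1
  simp only [mgf, one_mul, one_pow, mul_one] at h1 h2
  have hcc : (((‖c - -c‖₊ / 2) ^ 2 : NNReal) : ℝ) = c ^ 2 := by
    push_cast
    rw [Real.norm_eq_abs, abs_of_nonneg (by linarith)]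
    ring
  rw [hcc] at h1
  simp only [Real.exp_sub, div_eq_mul_inv _ (Real.exp _)]
  rw [← ofReal_integral_eq_lintegral_ofReal (h2.mul_const _)
    (Filter.Eventually.of_forall fun a => by positivity), integral_mul_const,
    ENNReal.ofReal_le_one, ← div_eq_mul_inv, div_le_one (Real.exp_pos _)]
  exact h1

/-- A bounded random variable whose mean compensates its second moment has exponential moment at
most `1`, because `exp u ≤ 1 + u + u ^ 2` for `|u| ≤ 1`. -/
lemma lintegral_exp_le_one_of_abs_le_one {α : Type*} [MeasurableSpace α] {μ : Measure α}
    [IsProbabilityMeasure μ] {u : α → ℝ} (hu : Measurable u) (hbd : ∀ᵐ a ∂μ, |u a| ≤ 1)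
    (hint : ∫ a, u a ∂μ + ∫ a, u a ^ 2 ∂μ ≤ 0) :
    ∫⁻ a, ENNReal.ofReal (Real.exp (u a)) ∂μ ≤ 1 := by
  have h1 : Integrable u μ := .of_bound hu.aestronglyMeasurable 1 hbd
  have h2 : Integrable (fun a => u a ^ 2) μ := by
    refine .of_bound (hu.pow_const 2).aestronglyMeasurable 1 ?_
    filter_upwards [hbd] with a ha
    rw [Real.norm_eq_abs, abs_pow]
    exact pow_le_one₀ (abs_nonneg _) ha
  have h3 : Integrable (fun a => 1 + u a) μ := (integrable_const _).add h1
  have h4 : ∀ᵐ a ∂μ, Real.exp (u a) ≤ 1 + u a + u a ^ 2 := by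
    filter_upwards [hbd] with a ha
    have := abs_le.1 (Real.abs_exp_sub_one_sub_id_le ha)
    linarith [this.2]
  calc ∫⁻ a, ENNReal.ofReal (Real.exp (u a)) ∂μ
      ≤ ∫⁻ a, ENNReal.ofReal (1 + u a + u a ^ 2) ∂μ :=
        lintegral_mono_ae (h4.mono fun a ha => ENNReal.ofReal_le_ofReal ha)
    _ = ENNReal.ofReal (∫ a, 1 + u a + u a ^ 2 ∂μ) := by
        refine (ofReal_integral_eq_lintegral_ofReal (h3.add h2) ?_).symm
        exact h4.mono fun a ha => (Real.exp_pos _).le.trans ha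
    _ ≤ 1 := by
        rw [integral_add h3 h2, integral_add (integrable_const _) h1]
        simp only [integral_const, probReal_univ, smul_eq_mul, one_mul, ENNReal.ofReal_le_one]
        linarith

lemma ae_norm_le_of_ae_norm_sub_le {E : Type*} [NormedAddCommGroup E] [MeasurableSpace E]
    {μ : Measure E} {m : E} {s : ℝ} (hs : ∀ᵐ v ∂μ, ‖v - m‖ ≤ s) :
    ∀ᵐ v ∂μ, ‖v‖ ≤ ‖m‖ + s := by
  filter_upwards [hs] with v hv
  have := norm_le_norm_add_norm_sub' v m
  linarith

variable {E : Type*} [NormedAddCommGroup E] [MeasurableSpace E] [BorelSpace E]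
  [SecondCountableTopology E] {μ : Measure E} [IsProbabilityMeasure μ] {m : E} {s : ℝ}

lemma integrable_id_of_ae_norm_sub_le (hs : ∀ᵐ v ∂μ, ‖v - m‖ ≤ s) : Integrable (fun v : E => v) μ :=
  .of_bound measurable_id.aestronglyMeasurable _ (ae_norm_le_of_ae_norm_sub_le hs)

lemma integrable_norm_sq_of_ae_norm_sub_le (hs : ∀ᵐ v ∂μ, ‖v - m‖ ≤ s) :
    Integrable (fun v : E => ‖v‖ ^ 2) μ := by
  refine .of_bound (by fun_prop) ((‖m‖ + s) ^ 2) ?_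
  filter_upwards [ae_norm_le_of_ae_norm_sub_le hs] with v hv
  rw [Real.norm_eq_abs, abs_of_nonneg (by positivity)]
  gcongr

variable [InnerProductSpace ℝ E] [CompleteSpace E]

lemma integral_inner_sub_eq_zero (hs : ∀ᵐ v ∂μ, ‖v - m‖ ≤ s) (hm : ∫ v, v ∂μ = m) (a : E) :
    ∫ v, inner ℝ (m - v) a ∂μ = 0 := by
  have h1 := integrable_id_of_ae_norm_sub_le hs
  have h2 : Integrable (fun v => m - v) μ := (integrable_const _).sub h1
  have h3 := integral_inner (𝕜 := ℝ) h2 a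
  simp only [real_inner_comm a] at h3 ⊢
  rw [h3, integral_sub (integrable_const _) h1, hm]
  simp

lemma integral_norm_sub_sq_le (hs : ∀ᵐ v ∂μ, ‖v - m‖ ≤ s) (hm : ∫ v, v ∂μ = m) :
    Integrable (fun v => ‖v - m‖ ^ 2) μ ∧ ∫ v, ‖v - m‖ ^ 2 ∂μ ≤ ∫ v, ‖v‖ ^ 2 ∂μ := by
  have h1 := integrable_norm_sq_of_ae_norm_sub_le hs
  have h2 : Integrable (fun v => inner ℝ (m - v) m) μ :=
    ((integrable_const m).sub (integrable_id_of_ae_norm_sub_le hs)).inner_const m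
  have h3 : ∀ v, ‖v - m‖ ^ 2 = ‖v‖ ^ 2 + 2 * inner ℝ (m - v) m - ‖m‖ ^ 2 := fun v => by
    rw [norm_sub_sq_real, inner_sub_left, real_inner_self_eq_norm_sq]
    ring
  simp only [h3]
  have h4 : Integrable (fun v => ‖v‖ ^ 2 + 2 * inner ℝ (m - v) m) μ := h1.add (h2.const_mul 2)
  refine ⟨h4.sub (integrable_const _), ?_⟩
  rw [integral_sub h4 (integrable_const _), integral_add h1 (h2.const_mul 2), integral_const_mul,
    integral_inner_sub_eq_zero hs hm]
  simp

lemma lintegral_exp_inner_sub_le_one (hs0 : 0 ≤ s) (hs : ∀ᵐ v ∂μ, ‖v - m‖ ≤ s)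
    (hm : ∫ v, v ∂μ = m) (a : E) :
    ∫⁻ v, ENNReal.ofReal (Real.exp (inner ℝ (m - v) a - (s * ‖a‖) ^ 2 / 2)) ∂μ ≤ 1 := by
  refine lintegral_exp_sub_le_one_of_abs_le (by fun_prop) (by positivity) ?_
    (integral_inner_sub_eq_zero hs hm a)
  filter_upwards [hs] with v hv
  refine (abs_real_inner_le_norm _ _).trans ?_
  rw [norm_sub_rev]
  gcongr

/-- A Bernstein-type bound in which the compensator is the *observed* squared norm `‖v‖ ^ 2` and
not the worst-case noise level. It rests on `𝔼 ‖v - 𝔼 v‖ ^ 2 ≤ 𝔼 ‖v‖ ^ 2`. -/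
lemma lintegral_exp_inner_sub_norm_sq_le_one (hs : ∀ᵐ v ∂μ, ‖v - m‖ ≤ s) (hm : ∫ v, v ∂μ = m)
    {a : E} {k : ℝ} (hk : 0 ≤ k) (ha : ‖a‖ ≤ k) (hks : k * s ≤ 1 / 4)
    (hkv : ∀ᵐ v ∂μ, k * ‖v‖ ≤ 1 / 4) :
    ∫⁻ v, ENNReal.ofReal (Real.exp (inner ℝ (m - v) a - 4 * (k ^ 2 * ‖v‖ ^ 2))) ∂μ ≤ 1 := by
  have hI1 := integrable_norm_sq_of_ae_norm_sub_le hs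
  obtain ⟨hI2, hle⟩ := integral_norm_sub_sq_le hs hm
  have hI3 : Integrable (fun v => inner ℝ (m - v) a) μ :=
    ((integrable_const m).sub (integrable_id_of_ae_norm_sub_le hs)).inner_const a
  have hinner : ∀ v, |inner ℝ (m - v) a| ≤ k * ‖v - m‖ := fun v => by
    refine (abs_real_inner_le_norm _ _).trans ?_
    rw [norm_sub_rev, mul_comm]
    gcongr
  refine lintegral_exp_le_one_of_abs_le_one (by fun_prop) ?_ ?_
  · filter_upwards [hs, hkv] with v hv hv'
    have h1 : k * ‖v - m‖ ≤ 1 / 4 := (mul_le_mul_of_nonneg_left hv hk).trans hks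
    have h2 := abs_le.1 ((hinner v).trans h1)
    have h3 : (k * ‖v‖) ^ 2 ≤ (1 / 4) ^ 2 := by gcongr
    rw [mul_pow] at h3
    have h4 : 0 ≤ k ^ 2 * ‖v‖ ^ 2 := by positivity
    rw [abs_le]
    constructor <;> linarith [h2.1, h2.2]
  · have h1 : ∫ v, (inner ℝ (m - v) a - 4 * (k ^ 2 * ‖v‖ ^ 2)) ^ 2 ∂μ ≤
        ∫ v, (2 * k ^ 2 * ‖v - m‖ ^ 2 + 2 * k ^ 2 * ‖v‖ ^ 2) ∂μ := by
      refine integral_mono_of_nonneg (Filter.Eventually.of_forall fun v => sq_nonneg _)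
        ((hI2.const_mul _).add (hI1.const_mul _)) ?_
      filter_upwards [hkv] with v hv
      have h3 : (k * ‖v‖) ^ 2 ≤ (1 / 4) ^ 2 := by gcongr
      rw [mul_pow] at h3
      have h4 : 0 ≤ k ^ 2 * ‖v‖ ^ 2 := by positivity
      have h5 : (inner ℝ (m - v) a) ^ 2 ≤ (k * ‖v - m‖) ^ 2 := sq_le_sq.2 <| by
        rw [abs_of_nonneg (by positivity : 0 ≤ k * ‖v - m‖)]; exact hinner v
      have h6 := sq_nonneg (inner ℝ (m - v) a + 4 * (k ^ 2 * ‖v‖ ^ 2))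
      rw [mul_pow] at h5
      nlinarith
    rw [integral_add (hI2.const_mul _) (hI1.const_mul _), integral_const_mul,
      integral_const_mul] at h1
    rw [integral_sub hI3 ((hI1.const_mul _).const_mul _), integral_inner_sub_eq_zero hs hm,
      integral_const_mul, integral_const_mul]
    have h2 := mul_le_mul_of_nonneg_left hle (by positivity : 0 ≤ 2 * k ^ 2)
    linarith

/-- The squared noise is dominated, up to a factor `2`, by the observed squared norm. -/
lemma lintegral_exp_norm_sub_sq_sub_le_one (hs : ∀ᵐ v ∂μ, ‖v - m‖ ≤ s) (hm : ∫ v, v ∂μ = m)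
    {k : ℝ} (hk : 0 ≤ k) (hks : k * s ^ 2 ≤ 1 / 10) (hkv : ∀ᵐ v ∂μ, k * ‖v‖ ^ 2 ≤ 1 / 10) :
    ∫⁻ v, ENNReal.ofReal (Real.exp (k * ‖v - m‖ ^ 2 - 2 * (k * ‖v‖ ^ 2))) ∂μ ≤ 1 := by
  have hI1 := integrable_norm_sq_of_ae_norm_sub_le hs
  obtain ⟨hI2, hle⟩ := integral_norm_sub_sq_le hs hm
  have hbd : ∀ᵐ v ∂μ, k * ‖v - m‖ ^ 2 ≤ 1 / 10 := by
    filter_upwards [hs] with v hv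
    refine le_trans ?_ hks
    gcongr
  refine lintegral_exp_le_one_of_abs_le_one (by fun_prop) ?_ ?_
  · filter_upwards [hbd, hkv] with v hv hv'
    have h1 : 0 ≤ k * ‖v - m‖ ^ 2 := by positivity
    have h2 : 0 ≤ k * ‖v‖ ^ 2 := by positivity
    rw [abs_le]
    constructor <;> linarith
  · have h1 : ∫ v, (k * ‖v - m‖ ^ 2 - 2 * (k * ‖v‖ ^ 2)) ^ 2 ∂μ ≤
        ∫ v, (1 / 10 * (k * ‖v - m‖ ^ 2) + 4 / 10 * (k * ‖v‖ ^ 2)) ∂μ := by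
      refine integral_mono_of_nonneg (Filter.Eventually.of_forall fun v => sq_nonneg _)
        (((hI2.const_mul _).const_mul _).add ((hI1.const_mul _).const_mul _)) ?_
      filter_upwards [hbd, hkv] with v hv hv'
      have h1 : 0 ≤ k * ‖v - m‖ ^ 2 := by positivity
      have h2 : 0 ≤ k * ‖v‖ ^ 2 := by positivity
      nlinarith
    rw [integral_add ((hI2.const_mul _).const_mul _) ((hI1.const_mul _).const_mul _)] at h1
    rw [integral_sub (hI2.const_mul _) ((hI1.const_mul _).const_mul _)]
    simp only [integral_const_mul] at h1 ⊢
    have h2 := mul_le_mul_of_nonneg_left hle hk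
    have h3 : 0 ≤ k * ∫ v, ‖v‖ ^ 2 ∂μ :=
      mul_nonneg hk (integral_nonneg fun v => sq_nonneg _)
    linarith

end OneStep

/-! ### One step of the algorithm -/

section PerStep

variable {d : ℕ} {f : EuclideanSpace ℝ (Fin d) → ℝ} {β σ₀ σ₁ η γ : ℝ}

/-- The squared noise level `σ₀² + σ₁² ‖∇f(w)‖²` of the oracle at `w`. -/
noncomputable def noiseSq (f : EuclideanSpace ℝ (Fin d) → ℝ) (σ₀ σ₁ : ℝ)
    (w : EuclideanSpace ℝ (Fin d)) : ℝ :=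
  σ₀ ^ 2 + σ₁ ^ 2 * ‖∇ f w‖ ^ 2

lemma noiseSq_nonneg (w : EuclideanSpace ℝ (Fin d)) : 0 ≤ noiseSq f σ₀ σ₁ w := by
  unfold noiseSq; positivity

/-- Increment of the exponential supermartingale that controls the function values. It belongs to
the martingale difference `⟪∇f(w) - v, ∇f(w)⟫` weighted by the decorrelated step size
`η / √(S + σ₀² + (1 + σ₁²) ‖∇f(w)‖²)`, which does not look at the current stochastic gradient `v`;
`1 / (2 * A)` is the exponential parameter. -/
noncomputable def gapInc (f : EuclideanSpace ℝ (Fin d) → ℝ) (σ₀ σ₁ η A : ℝ)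
    (w : EuclideanSpace ℝ (Fin d)) (S : ℝ) (v : EuclideanSpace ℝ (Fin d)) : ℝ :=
  inner ℝ (∇ f w - v) ((η / √(S + noiseSq f σ₀ σ₁ w + ‖∇ f w‖ ^ 2) / (2 * A)) • ∇ f w) -
    (√(noiseSq f σ₀ σ₁ w) * ‖(η / √(S + noiseSq f σ₀ σ₁ w + ‖∇ f w‖ ^ 2) / (2 * A)) • ∇ f w‖) ^ 2
      / 2

open Classical in
/-- Increment of the exponential supermartingale that controls the distance to the minimizer,
switched off outside the region where the distance is at most `D` and the gap at most `F`. The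
decorrelated step size is `η / √(S + ‖∇f(w)‖²)`. -/
noncomputable def distInc (f : EuclideanSpace ℝ (Fin d) → ℝ) (z : EuclideanSpace ℝ (Fin d))
    (D F B : ℝ) (w : EuclideanSpace ℝ (Fin d)) (S : ℝ) (v : EuclideanSpace ℝ (Fin d)) : ℝ :=
  if ‖w - z‖ ≤ D ∧ f w - f z ≤ F then
    inner ℝ (∇ f w - v) ((1 / (4 * (√B * √(S + ‖∇ f w‖ ^ 2))) / D) • (w - z)) -
      4 * ((1 / (4 * (√B * √(S + ‖∇ f w‖ ^ 2)))) ^ 2 * ‖v‖ ^ 2)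
  else 0

open Classical in
/-- Increment of the exponential supermartingale that compares the squared noise with the observed
squared norm of the stochastic gradient, both divided by `S + ‖∇f(w)‖²`. -/
noncomputable def noiseInc (f : EuclideanSpace ℝ (Fin d) → ℝ) (z : EuclideanSpace ℝ (Fin d))
    (F B : ℝ) (w : EuclideanSpace ℝ (Fin d)) (S : ℝ) (v : EuclideanSpace ℝ (Fin d)) : ℝ :=
  if f w - f z ≤ F then
    1 / (10 * B * (S + ‖∇ f w‖ ^ 2)) * ‖v - ∇ f w‖ ^ 2 -
      2 * (1 / (10 * B * (S + ‖∇ f w‖ ^ 2)) * ‖v‖ ^ 2)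
  else 0

/-- Increment of the exponential supermartingale that controls the noise in the regret, with
exponential parameter `a`. -/
noncomputable def regretInc (f : EuclideanSpace ℝ (Fin d) → ℝ) (z : EuclideanSpace ℝ (Fin d))
    (σ₀ σ₁ a : ℝ) (w : EuclideanSpace ℝ (Fin d)) (v : EuclideanSpace ℝ (Fin d)) : ℝ :=
  inner ℝ (∇ f w - v) (a • (w - z)) - (√(noiseSq f σ₀ σ₁ w) * ‖a • (w - z)‖) ^ 2 / 2

lemma abs_sqrt_sub_sqrt_le {a b s : ℝ} (ha : 0 < a) (hb : 0 < b) (h : |a - b| ≤ s * (√a + √b)) :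
    |√a - √b| ≤ s := by
  have h1 : a - b = (√a - √b) * (√a + √b) := by
    nlinarith [Real.sq_sqrt ha.le, Real.sq_sqrt hb.le]
  have h2 : 0 < √a + √b := add_pos (Real.sqrt_pos.2 ha) (Real.sqrt_pos.2 hb)
  rw [h1, abs_mul, abs_of_pos h2] at h
  exact le_of_mul_le_mul_right h h2

/-- Replacing the actual step size `η / √b` by a decorrelated one `η / √a`. -/
lemma div_sqrt_sub_div_sqrt_mul_le {a b s x y p : ℝ} (hη : 0 ≤ η) (ha : 0 < a) (hb : 0 < b)
    (hs : |√a - √b| ≤ s) (hp : |p| ≤ x * y) :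
    (η / √a - η / √b) * p ≤ η * s * x * y / (√a * √b) := by
  have ha' := Real.sqrt_pos.2 ha
  have hb' := Real.sqrt_pos.2 hb
  have h1 : (η / √a - η / √b) * p = η * ((√b - √a) * p) / (√a * √b) := by
    field_simp
  rw [h1]
  refine div_le_div_of_nonneg_right ?_ (by positivity)
  have h2 : (√b - √a) * p ≤ s * (x * y) := by
    refine (le_abs_self _).trans ?_
    rw [abs_mul, abs_sub_comm]
    exact mul_le_mul hs hp (abs_nonneg _) ((abs_nonneg _).trans hs)
  calc η * ((√b - √a) * p) ≤ η * (s * (x * y)) := by gcongr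
    _ = _ := by ring

/-- One step of AdaGrad-norm in function value. -/
lemma apply_step_le (hη : 0 < η) (hγ : 0 < γ) (hf : ConvexOn ℝ Set.univ f)
    (hs : IsSmoothWith β f) {w v : EuclideanSpace ℝ (Fin d)} {S A : ℝ} (hS : γ ^ 2 ≤ S)
    (hv : ‖v - ∇ f w‖ ^ 2 ≤ noiseSq f σ₀ σ₁ w) (hA : 0 < A)
    (hA1 : η * √(noiseSq f σ₀ σ₁ w) ≤ A) (hA2 : β * η ^ 2 ≤ A) :
    f (w - (η / √(S + ‖v‖ ^ 2)) • v) ≤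
      f w + 2 * A * gapInc f σ₀ σ₁ η A w S v + 5 * A * (‖v‖ ^ 2 / (S + ‖v‖ ^ 2)) := by
  have hS0 : 0 < S := lt_of_lt_of_le (by positivity) hS
  have hn := noiseSq_nonneg (f := f) (σ₀ := σ₀) (σ₁ := σ₁) w
  have h1 := le_add_inner_gradient_add hf hs w (w - (η / √(S + ‖v‖ ^ 2)) • v)
  rw [sub_sub_cancel_left, inner_neg_right, inner_smul_right, norm_neg, norm_smul, mul_pow,
    Real.norm_eq_abs, sq_abs, div_pow, Real.sq_sqrt (by positivity)] at h1
  unfold gapInc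
  set m := ∇ f w with hm
  set s := √(noiseSq f σ₀ σ₁ w) with hsdef
  have hs0 : 0 ≤ s := Real.sqrt_nonneg _
  have hs2 : s ^ 2 = noiseSq f σ₀ σ₁ w := Real.sq_sqrt hn
  have hvs : ‖v - m‖ ≤ s := Real.le_sqrt_of_sq_le hv
  rw [← hs2]
  have ha : 0 < S + s ^ 2 + ‖m‖ ^ 2 := by positivity
  have hb : 0 < S + ‖v‖ ^ 2 := by positivity
  have hsa : s ≤ √(S + s ^ 2 + ‖m‖ ^ 2) :=
    Real.le_sqrt_of_sq_le (by nlinarith [sq_nonneg ‖m‖])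
  have hma : ‖m‖ ≤ √(S + s ^ 2 + ‖m‖ ^ 2) :=
    Real.le_sqrt_of_sq_le (by nlinarith [sq_nonneg s])
  have hvb : ‖v‖ ≤ √(S + ‖v‖ ^ 2) := Real.le_sqrt_of_sq_le (by linarith)
  have hdiff : |√(S + s ^ 2 + ‖m‖ ^ 2) - √(S + ‖v‖ ^ 2)| ≤ 2 * s := by
    refine abs_sqrt_sub_sqrt_le ha hb ?_
    have h2 : |‖m‖ - ‖v‖| ≤ s := (abs_norm_sub_norm_le m v).trans (by rwa [norm_sub_rev])
    have h3 : |S + s ^ 2 + ‖m‖ ^ 2 - (S + ‖v‖ ^ 2)| ≤ s ^ 2 + s * (‖m‖ + ‖v‖) := by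
      have h4 : S + s ^ 2 + ‖m‖ ^ 2 - (S + ‖v‖ ^ 2) = s ^ 2 + (‖m‖ - ‖v‖) * (‖m‖ + ‖v‖) := by ring
      rw [h4]
      refine (abs_add_le _ _).trans ?_
      rw [abs_of_nonneg (sq_nonneg s), abs_mul, abs_of_nonneg (by positivity : 0 ≤ ‖m‖ + ‖v‖)]
      gcongr
    nlinarith [Real.sqrt_nonneg (S + ‖v‖ ^ 2)]
  have h2 := div_sqrt_sub_div_sqrt_mul_le hη.le ha hb hdiff (abs_real_inner_le_norm m v)
  set a := √(S + s ^ 2 + ‖m‖ ^ 2) with hadef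
  have hb2 := Real.sq_sqrt hb.le
  rw [← hb2] at h1 ⊢
  rw [Real.sqrt_sq (Real.sqrt_nonneg _)] at *
  set b := √(S + ‖v‖ ^ 2) with hbdef
  have ha' : 0 < a := Real.sqrt_pos.2 ha
  have hb' : 0 < b := Real.sqrt_pos.2 hb
  -- the decorrelation error is split between the drift and the logarithmic sum
  have h3 : η * (2 * s) * ‖m‖ * ‖v‖ / (a * b) ≤
      1 / 4 * (η / a * ‖m‖ ^ 2) + 4 * A * (‖v‖ ^ 2 / b ^ 2) := by
    have h4 : η * (2 * s) * ‖m‖ * ‖v‖ / (a * b) = η / a * (2 * (‖m‖ / 2) * (2 * s * (‖v‖ / b))) := by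
      field_simp
    have h5 := two_mul_le_add_sq (‖m‖ / 2) (2 * s * (‖v‖ / b))
    have h6 : η * s * (s / a) ≤ A := by
      refine le_trans (mul_le_of_le_one_right (by positivity) ?_) hA1
      rwa [div_le_one ha']
    calc _ = _ := h4
      _ ≤ η / a * ((‖m‖ / 2) ^ 2 + (2 * s * (‖v‖ / b)) ^ 2) := by gcongr
      _ = 1 / 4 * (η / a * ‖m‖ ^ 2) + 4 * (η * s * (s / a)) * (‖v‖ ^ 2 / b ^ 2) := by
        field_simp; ring
      _ ≤ _ := by gcongr
  -- the compensator of the martingale costs a quarter of the drift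
  have h7 : 2 * A * ((s * ‖(η / a / (2 * A)) • m‖) ^ 2 / 2) ≤ 1 / 4 * (η / a * ‖m‖ ^ 2) := by
    have h8 : η / a * s ^ 2 ≤ A := by
      calc η / a * s ^ 2 = η * s * (s / a) := by field_simp
        _ ≤ A := le_trans (mul_le_of_le_one_right (by positivity) ((div_le_one ha').2 hsa)) hA1
    rw [norm_smul, Real.norm_of_nonneg (by positivity)]
    calc 2 * A * ((s * (η / a / (2 * A) * ‖m‖)) ^ 2 / 2)
        = 1 / 4 * (η / a * ‖m‖ ^ 2) * (η / a * s ^ 2 / A) := by field_simp; ring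
      _ ≤ 1 / 4 * (η / a * ‖m‖ ^ 2) * 1 := by
        gcongr
        rwa [div_le_one hA]
      _ = _ := mul_one _
  have h9 : 2 * A * inner ℝ (m - v) ((η / a / (2 * A)) • m) =
      η / a * ‖m‖ ^ 2 - η / a * inner ℝ m v := by
    rw [inner_smul_right, inner_sub_left, real_inner_self_eq_norm_sq, real_inner_comm m v]
    field_simp
  have h10 : β * (η ^ 2 / b ^ 2 * ‖v‖ ^ 2) ≤ A * (‖v‖ ^ 2 / b ^ 2) := by
    calc _ = β * η ^ 2 * (‖v‖ ^ 2 / b ^ 2) := by ring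
      _ ≤ _ := by gcongr
  have h11 : 0 ≤ η / a * ‖m‖ ^ 2 := by positivity
  rw [mul_sub, h9]
  linarith

lemma norm_sq_le_mul_add {v m : EuclideanSpace ℝ (Fin d)} {S B R : ℝ} (hS : γ ^ 2 ≤ S)
    (hR : 0 ≤ R) (hB : B = 2 * (1 + R)) (hv : ‖v - m‖ ^ 2 ≤ R * γ ^ 2) :
    ‖v‖ ^ 2 ≤ B * (S + ‖m‖ ^ 2) := by
  have h2 := norm_le_norm_add_norm_sub' v m
  have h3 : ‖v‖ ^ 2 ≤ (‖m‖ + ‖v - m‖) ^ 2 := by gcongr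
  have h4 : R * γ ^ 2 ≤ R * S := by gcongr
  have h5 : 0 ≤ R * ‖m‖ ^ 2 := by positivity
  have h6 := sq_nonneg (‖m‖ - ‖v - m‖)
  rw [hB]
  nlinarith [sq_nonneg γ]

/-- One step of AdaGrad-norm in squared distance to the minimizer `z`. -/
lemma norm_step_sub_sq_le (hη : 0 < η) (hγ : 0 < γ) (hf : ConvexOn ℝ Set.univ f)
    (hd : Differentiable ℝ f) {w v z : EuclideanSpace ℝ (Fin d)} (hmin : ∀ x, f z ≤ f x)
    {S D F B R : ℝ} (hS : γ ^ 2 ≤ S) (hv : ‖v - ∇ f w‖ ^ 2 ≤ R * γ ^ 2) (hR : 0 ≤ R)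
    (hB : B = 2 * (1 + R)) (hD : 0 < D) (hwD : ‖w - z‖ ≤ D) (hwF : f w - f z ≤ F) :
    ‖w - (η / √(S + ‖v‖ ^ 2)) • v - z‖ ^ 2 ≤ ‖w - z‖ ^ 2 +
      8 * D * η * √B * distInc f z D F B w S v + 10 * B * η * D * noiseInc f z F B w S v +
      (13 * (η * D * (1 + R)) + η ^ 2) * (‖v‖ ^ 2 / (S + ‖v‖ ^ 2)) := by
  have hS0 : 0 < S := lt_of_lt_of_le (by positivity) hS
  have hB2 : 2 ≤ B := by linarith
  rw [distInc, if_pos ⟨hwD, hwF⟩, noiseInc, if_pos hwF]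
  have hconv : 0 ≤ inner ℝ (∇ f w) (w - z) := by
    have h1 := add_inner_gradient_le hf hd w z
    have h2 := hmin w
    rw [← neg_sub w z, inner_neg_right] at h1
    linarith
  set m := ∇ f w with hm
  set u := w - z with hu
  have hexp : ‖w - (η / √(S + ‖v‖ ^ 2)) • v - z‖ ^ 2 =
      ‖u‖ ^ 2 - 2 * (η / √(S + ‖v‖ ^ 2) * inner ℝ v u) + η ^ 2 * (‖v‖ ^ 2 / (S + ‖v‖ ^ 2)) := by
    rw [sub_right_comm, ← hu, norm_sub_sq_real, inner_smul_right, norm_smul, mul_pow,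
      Real.norm_eq_abs, sq_abs, div_pow, Real.sq_sqrt (by positivity), real_inner_comm]
    ring
  have ha : 0 < S + ‖m‖ ^ 2 := by positivity
  have hb : 0 < S + ‖v‖ ^ 2 := by positivity
  have hma : ‖m‖ ≤ √(S + ‖m‖ ^ 2) := Real.le_sqrt_of_sq_le (by linarith)
  have hvb : ‖v‖ ≤ √(S + ‖v‖ ^ 2) := Real.le_sqrt_of_sq_le (by linarith)
  have hdiff : |√(S + ‖m‖ ^ 2) - √(S + ‖v‖ ^ 2)| ≤ ‖v - m‖ := by
    refine abs_sqrt_sub_sqrt_le ha hb ?_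
    have h2 : |‖m‖ - ‖v‖| ≤ ‖v - m‖ := (abs_norm_sub_norm_le m v).trans (by rw [norm_sub_rev])
    have h4 : S + ‖m‖ ^ 2 - (S + ‖v‖ ^ 2) = (‖m‖ - ‖v‖) * (‖m‖ + ‖v‖) := by ring
    rw [h4, abs_mul, abs_of_nonneg (by positivity : 0 ≤ ‖m‖ + ‖v‖)]
    gcongr
  have hinner : |inner ℝ v u| ≤ ‖v‖ * D :=
    (abs_real_inner_le_norm v u).trans (by gcongr)
  have h1 := div_sqrt_sub_div_sqrt_mul_le hη.le ha hb hdiff hinner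
  have hv2 : ‖v‖ ^ 2 ≤ B * (S + ‖m‖ ^ 2) := norm_sq_le_mul_add hS hR hB hv
  have hb2 := Real.sq_sqrt hb.le
  have ha2 := Real.sq_sqrt ha.le
  have hbpos := Real.sqrt_pos.2 hb
  have hapos := Real.sqrt_pos.2 ha
  have hBpos : 0 < √B := Real.sqrt_pos.2 (by linarith)
  have hBsq : √B ^ 2 = B := Real.sq_sqrt (by linarith)
  have hB1 : 1 ≤ √B := Real.one_le_sqrt.2 (by linarith)
  -- the observed squared norms with the decorrelated and with the actual denominator
  have hY : ‖v‖ ^ 2 / (S + ‖m‖ ^ 2) ≤ 3 * (1 + R) * (‖v‖ ^ 2 / (S + ‖v‖ ^ 2)) := by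
    have h2 : S + ‖v‖ ^ 2 ≤ 3 * (1 + R) * (S + ‖m‖ ^ 2) := by
      have h3 : 0 ≤ R * (S + ‖m‖ ^ 2) := by positivity
      have h4 : 0 ≤ ‖m‖ ^ 2 := by positivity
      subst hB
      linarith
    rw [← mul_div_assoc, div_le_div_iff₀ ha hb]
    calc ‖v‖ ^ 2 * (S + ‖v‖ ^ 2) ≤ ‖v‖ ^ 2 * (3 * (1 + R) * (S + ‖m‖ ^ 2)) := by gcongr
      _ = _ := by ring
  have hcross : η * ‖v - m‖ * ‖v‖ * D / (√(S + ‖m‖ ^ 2) * √(S + ‖v‖ ^ 2)) ≤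
      η * D / 2 * (‖v‖ ^ 2 / (S + ‖v‖ ^ 2) + ‖v - m‖ ^ 2 / (S + ‖m‖ ^ 2)) := by
    have h2 := two_mul_le_add_sq (‖v‖ / √(S + ‖v‖ ^ 2)) (‖v - m‖ / √(S + ‖m‖ ^ 2))
    rw [div_pow, div_pow, ha2, hb2] at h2
    calc _ = η * D / 2 * (2 * (‖v‖ / √(S + ‖v‖ ^ 2)) * (‖v - m‖ / √(S + ‖m‖ ^ 2))) := by
          field_simp
      _ ≤ _ := by gcongr
  have hX : 8 * D * η * √B * (inner ℝ (m - v) ((1 / (4 * (√B * √(S + ‖m‖ ^ 2))) / D) • u) -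
      4 * ((1 / (4 * (√B * √(S + ‖m‖ ^ 2)))) ^ 2 * ‖v‖ ^ 2)) =
      2 * (η / √(S + ‖m‖ ^ 2) * (inner ℝ m u - inner ℝ v u)) -
        2 * (η * D) * (‖v‖ ^ 2 / (S + ‖m‖ ^ 2)) / √B := by
    rw [inner_smul_right, inner_sub_left, ← ha2, Real.sqrt_sq hapos.le]
    field_simp
    ring
  have hW : 10 * B * η * D * (1 / (10 * B * (S + ‖m‖ ^ 2)) * ‖v - m‖ ^ 2 -
      2 * (1 / (10 * B * (S + ‖m‖ ^ 2)) * ‖v‖ ^ 2)) =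
      η * D * (‖v - m‖ ^ 2 / (S + ‖m‖ ^ 2)) - 2 * (η * D) * (‖v‖ ^ 2 / (S + ‖m‖ ^ 2)) := by
    have : 0 < B := by linarith
    field_simp
  rw [hexp, hX, hW]
  have h12 : 2 * (η * D) * (‖v‖ ^ 2 / (S + ‖m‖ ^ 2)) / √B ≤
      2 * (η * D) * (‖v‖ ^ 2 / (S + ‖m‖ ^ 2)) := div_le_self (by positivity) hB1
  have h13 := mul_le_mul_of_nonneg_left hY (by positivity : 0 ≤ 4 * (η * D))
  have h14 : 0 ≤ η / √(S + ‖m‖ ^ 2) * inner ℝ m u := by positivity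
  have h15 : 0 ≤ η * D * R * (‖v‖ ^ 2 / (S + ‖v‖ ^ 2)) := by positivity
  have h16 := h1.trans hcross
  generalize ‖v‖ ^ 2 / (S + ‖v‖ ^ 2) = N at *
  generalize ‖v‖ ^ 2 / (S + ‖m‖ ^ 2) = Y at *
  generalize ‖v - m‖ ^ 2 / (S + ‖m‖ ^ 2) = W at *
  generalize η / √(S + ‖m‖ ^ 2) = a at *
  generalize η / √(S + ‖v‖ ^ 2) = b at *
  linarith

end PerStep

/-! ### The increments are exponential supermartingale increments -/

section Increments

variable {d : ℕ} {f : EuclideanSpace ℝ (Fin d) → ℝ} {β σ₀ σ₁ η γ : ℝ}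
  {κ : Kernel (EuclideanSpace ℝ (Fin d)) (EuclideanSpace ℝ (Fin d))}

lemma IsAffineNoiseOracle.ae_norm_sub_le (hκ : IsAffineNoiseOracle f σ₀ σ₁ κ)
    (w : EuclideanSpace ℝ (Fin d)) : ∀ᵐ v ∂κ w, ‖v - ∇ f w‖ ≤ √(noiseSq f σ₀ σ₁ w) := by
  filter_upwards [hκ.noise w] with v hv
  exact Real.le_sqrt_of_sq_le hv

lemma measurable_gapInc (hs : IsSmoothWith β f) (A : ℝ) :
    Measurable fun q : EuclideanSpace ℝ (Fin d) × ℝ × EuclideanSpace ℝ (Fin d) =>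
      gapInc f σ₀ σ₁ η A q.1 q.2.1 q.2.2 := by
  have h := hs.continuous_gradient.measurable
  unfold gapInc noiseSq
  generalize ∇ f = G at *
  fun_prop

lemma measurable_distInc (hs : IsSmoothWith β f) (z : EuclideanSpace ℝ (Fin d)) (D F B : ℝ) :
    Measurable fun q : EuclideanSpace ℝ (Fin d) × ℝ × EuclideanSpace ℝ (Fin d) =>
      distInc f z D F B q.1 q.2.1 q.2.2 := by
  have h := hs.continuous_gradient.measurable
  have hf := hs.1.continuous.measurable
  unfold distInc
  generalize ∇ f = G at *
  refine Measurable.ite ?_ (by fun_prop) measurable_const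
  have h1 : MeasurableSet {q : EuclideanSpace ℝ (Fin d) × ℝ × EuclideanSpace ℝ (Fin d) |
      ‖q.1 - z‖ ≤ D} := measurableSet_le (by fun_prop) (by fun_prop)
  have h2 : MeasurableSet {q : EuclideanSpace ℝ (Fin d) × ℝ × EuclideanSpace ℝ (Fin d) |
      f q.1 - f z ≤ F} := measurableSet_le (by fun_prop) (by fun_prop)
  exact h1.inter h2

lemma measurable_noiseInc (hs : IsSmoothWith β f) (z : EuclideanSpace ℝ (Fin d)) (F B : ℝ) :
    Measurable fun q : EuclideanSpace ℝ (Fin d) × ℝ × EuclideanSpace ℝ (Fin d) =>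
      noiseInc f z F B q.1 q.2.1 q.2.2 := by
  have h := hs.continuous_gradient.measurable
  have hf := hs.1.continuous.measurable
  unfold noiseInc
  generalize ∇ f = G at *
  exact Measurable.ite (measurableSet_le (by fun_prop) (by fun_prop)) (by fun_prop)
    measurable_const

lemma measurable_regretInc (hs : IsSmoothWith β f) (z : EuclideanSpace ℝ (Fin d)) (a : ℝ) :
    Measurable fun q : EuclideanSpace ℝ (Fin d) × ℝ × EuclideanSpace ℝ (Fin d) =>
      regretInc f z σ₀ σ₁ a q.1 q.2.2 := by
  have h := hs.continuous_gradient.measurable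
  unfold regretInc noiseSq
  generalize ∇ f = G at *
  fun_prop

lemma measurableSet_noise (hs : IsSmoothWith β f) :
    MeasurableSet {q : EuclideanSpace ℝ (Fin d) × EuclideanSpace ℝ (Fin d) |
      ‖q.2 - ∇ f q.1‖ ^ 2 ≤ noiseSq f σ₀ σ₁ q.1} := by
  have h := hs.continuous_gradient.measurable
  unfold noiseSq
  generalize ∇ f = G at *
  exact measurableSet_le (by fun_prop) (by fun_prop)

variable [IsMarkovKernel κ]

lemma IsAffineNoiseOracle.lintegral_exp_gapInc_le (hκ : IsAffineNoiseOracle f σ₀ σ₁ κ) (A : ℝ)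
    (w : EuclideanSpace ℝ (Fin d)) (S : ℝ) :
    ∫⁻ v, ENNReal.ofReal (Real.exp (gapInc f σ₀ σ₁ η A w S v)) ∂κ w ≤ 1 :=
  lintegral_exp_inner_sub_le_one (Real.sqrt_nonneg _) (hκ.ae_norm_sub_le w) (hκ.unbiased w) _

lemma IsAffineNoiseOracle.lintegral_exp_regretInc_le (hκ : IsAffineNoiseOracle f σ₀ σ₁ κ) (a : ℝ)
    (z w : EuclideanSpace ℝ (Fin d)) :
    ∫⁻ v, ENNReal.ofReal (Real.exp (regretInc f z σ₀ σ₁ a w v)) ∂κ w ≤ 1 :=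
  lintegral_exp_inner_sub_le_one (Real.sqrt_nonneg _) (hκ.ae_norm_sub_le w) (hκ.unbiased w) _

lemma IsAffineNoiseOracle.lintegral_exp_distInc_le (hκ : IsAffineNoiseOracle f σ₀ σ₁ κ)
    (hγ : 0 < γ) {z : EuclideanSpace ℝ (Fin d)} {D F B R : ℝ} (hD : 0 < D) (hR : 0 ≤ R)
    (hB : B = 2 * (1 + R)) (hN : ∀ w, f w - f z ≤ F → noiseSq f σ₀ σ₁ w ≤ R * γ ^ 2)
    (w : EuclideanSpace ℝ (Fin d)) {S : ℝ} (hS : γ ^ 2 ≤ S) :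
    ∫⁻ v, ENNReal.ofReal (Real.exp (distInc f z D F B w S v)) ∂κ w ≤ 1 := by
  by_cases hw : ‖w - z‖ ≤ D ∧ f w - f z ≤ F
  swap
  · simp only [distInc, if_neg hw]
    simp
  simp only [distInc, if_pos hw]
  have hS0 : 0 < S := lt_of_lt_of_le (by positivity) hS
  have hB0 : 0 < B := by linarith
  have hC : 0 < √(B * (S + ‖∇ f w‖ ^ 2)) := Real.sqrt_pos.2 (by positivity)
  have hC2 : √B * √(S + ‖∇ f w‖ ^ 2) = √(B * (S + ‖∇ f w‖ ^ 2)) :=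
    (Real.sqrt_mul hB0.le _).symm
  have hdiv : ∀ x, x ≤ √(B * (S + ‖∇ f w‖ ^ 2)) →
      1 / (4 * √(B * (S + ‖∇ f w‖ ^ 2))) * x ≤ 1 / 4 := fun x hx => by
    rw [one_div_mul_eq_div, div_le_div_iff₀ (by positivity) (by norm_num)]
    linarith
  rw [hC2]
  refine lintegral_exp_inner_sub_norm_sq_le_one (hκ.ae_norm_sub_le w) (hκ.unbiased w)
    (by positivity) ?_ ?_ ?_
  · rw [norm_smul, Real.norm_of_nonneg (by positivity), div_mul_eq_mul_div]
    exact div_le_of_le_mul₀ hD.le (by positivity) (by gcongr; exact hw.1)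
  · refine hdiv _ (Real.sqrt_le_sqrt ?_)
    have h1 : R * γ ^ 2 ≤ R * S := by gcongr
    have h2 : 0 ≤ B * ‖∇ f w‖ ^ 2 := by positivity
    have h3 : 0 ≤ R * S := by positivity
    have h4 := hN w hw.2
    rw [hB] at h2 ⊢
    linarith
  · filter_upwards [hκ.ae_norm_sub_le w] with v hv
    exact hdiv _ (Real.le_sqrt_of_sq_le (norm_sq_le_mul_add hS hR hB
      (((Real.le_sqrt (norm_nonneg _) (noiseSq_nonneg w)).1 hv).trans (hN w hw.2))))

lemma IsAffineNoiseOracle.lintegral_exp_noiseInc_le (hκ : IsAffineNoiseOracle f σ₀ σ₁ κ)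
    (hγ : 0 < γ) {z : EuclideanSpace ℝ (Fin d)} {F B R : ℝ} (hR : 0 ≤ R)
    (hB : B = 2 * (1 + R)) (hN : ∀ w, f w - f z ≤ F → noiseSq f σ₀ σ₁ w ≤ R * γ ^ 2)
    (w : EuclideanSpace ℝ (Fin d)) {S : ℝ} (hS : γ ^ 2 ≤ S) :
    ∫⁻ v, ENNReal.ofReal (Real.exp (noiseInc f z F B w S v)) ∂κ w ≤ 1 := by
  by_cases hw : f w - f z ≤ F
  swap
  · simp [noiseInc, hw]
  simp only [noiseInc, if_pos hw]
  have hS0 : 0 < S := lt_of_lt_of_le (by positivity) hS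
  have hB0 : 0 < B := by linarith
  have hdiv : ∀ x, x ≤ B * (S + ‖∇ f w‖ ^ 2) →
      1 / (10 * B * (S + ‖∇ f w‖ ^ 2)) * x ≤ 1 / 10 := fun x hx => by
    rw [one_div_mul_eq_div, div_le_div_iff₀ (by positivity) (by norm_num)]
    linarith
  refine lintegral_exp_norm_sub_sq_sub_le_one (hκ.ae_norm_sub_le w) (hκ.unbiased w)
    (by positivity) ?_ ?_
  · rw [Real.sq_sqrt (noiseSq_nonneg w)]
    refine hdiv _ ?_
    have h1 : R * γ ^ 2 ≤ R * S := by gcongr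
    have h2 : 0 ≤ B * ‖∇ f w‖ ^ 2 := by positivity
    have h3 : 0 ≤ R * S := by positivity
    have h4 := hN w hw
    rw [hB] at h2 ⊢
    linarith
  · filter_upwards [hκ.ae_norm_sub_le w] with v hv
    exact hdiv _ (norm_sq_le_mul_add hS hR hB
      (((Real.le_sqrt (norm_nonneg _) (noiseSq_nonneg w)).1 hv).trans (hN w hw)))

end Increments

/-! ### Function values along a trajectory -/

section Trajectory

variable {d : ℕ} {f : EuclideanSpace ℝ (Fin d) → ℝ} {β σ₀ σ₁ η γ : ℝ}
  {w₁ z : EuclideanSpace ℝ (Fin d)} {x : ℕ → EuclideanSpace ℝ (Fin d)}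

lemma sqSum_pos (hγ : 0 < γ) (x : ℕ → EuclideanSpace ℝ (Fin d)) (t : ℕ) : 0 < sqSum γ x t :=
  lt_of_lt_of_le (by positivity) (sq_le_sqSum γ x t)

lemma iterate_succ (η γ : ℝ) (w₁ : EuclideanSpace ℝ (Fin d)) (x : ℕ → EuclideanSpace ℝ (Fin d))
    (t : ℕ) : iterate η γ w₁ x (t + 1) =
      iterate η γ w₁ x t - (η / √(sqSum γ x t + ‖x t‖ ^ 2)) • x t := by
  rw [← sqSum_succ]; rfl

lemma sum_norm_sq_div_sqSum_le (hγ : 0 < γ) (x : ℕ → EuclideanSpace ℝ (Fin d)) (n : ℕ) :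
    ∑ t ∈ Finset.range n, ‖x t‖ ^ 2 / (sqSum γ x t + ‖x t‖ ^ 2) ≤
      Real.log (sqSum γ x n / γ ^ 2) := by
  induction n with
  | zero => simp [sqSum, hγ.ne']
  | succ n ih =>
    have h0 := sqSum_pos hγ x n
    have h1 := sqSum_pos hγ x (n + 1)
    have h2 := Real.one_sub_inv_le_log_of_pos (div_pos h1 h0)
    rw [Real.log_div h1.ne' h0.ne'] at h2
    rw [Real.log_div h0.ne' (by positivity)] at ih
    rw [Finset.sum_range_succ, Real.log_div h1.ne' (by positivity), ← sqSum_succ]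
    have h3 : ‖x n‖ ^ 2 / sqSum γ x (n + 1) = 1 - (sqSum γ x (n + 1) / sqSum γ x n)⁻¹ := by
      rw [inv_div, sqSum_succ]
      rw [sqSum_succ] at h1
      field_simp
      ring
    linarith

lemma sum_norm_sq_div_sqrt_sqSum_le (hγ : 0 < γ) (x : ℕ → EuclideanSpace ℝ (Fin d)) (n : ℕ) :
    ∑ t ∈ Finset.range n, ‖x t‖ ^ 2 / √(sqSum γ x (t + 1)) ≤ 2 * (√(sqSum γ x n) - γ) := by
  induction n with
  | zero => simp [sqSum, hγ.le]
  | succ n ih =>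
    have h1 := Real.sqrt_pos.2 (sqSum_pos hγ x (n + 1))
    have h3 := Real.sq_sqrt (sqSum_pos hγ x n).le
    have h4 := Real.sq_sqrt (sqSum_pos hγ x (n + 1)).le
    have h5 := sqSum_succ γ x n
    rw [Finset.sum_range_succ]
    have h6 : ‖x n‖ ^ 2 / √(sqSum γ x (n + 1)) ≤
        2 * (√(sqSum γ x (n + 1)) - √(sqSum γ x n)) := by
      rw [div_le_iff₀ h1]
      nlinarith [sq_nonneg (√(sqSum γ x (n + 1)) - √(sqSum γ x n))]
    linarith

/-- Summation by parts for the telescoping part of the regret: the weights `√(sqSum γ x t)` are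
nondecreasing in `t`, and the numbers `r t` (squared distances) are at most `Q`. -/
lemma sum_sub_mul_sqrt_sqSum_le (hγ : 0 < γ) (x : ℕ → EuclideanSpace ℝ (Fin d)) {r : ℕ → ℝ}
    {Q : ℝ} {n : ℕ} (hr : ∀ t < n, r t ≤ Q) :
    ∑ t ∈ Finset.range n, (r t - r (t + 1)) * √(sqSum γ x (t + 1)) ≤
      γ * r 0 + Q * (√(sqSum γ x n) - γ) - r n * √(sqSum γ x n) := by
  induction n with
  | zero => simp [sqSum, hγ.le, mul_comm]
  | succ n ih =>
    have h1 : √(sqSum γ x n) ≤ √(sqSum γ x (n + 1)) :=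
      Real.sqrt_le_sqrt (by rw [sqSum_succ]; linarith [sq_nonneg ‖x n‖])
    have h2 := ih fun t ht => hr t (ht.trans n.lt_succ_self)
    have h3 := mul_le_mul_of_nonneg_right (hr n n.lt_succ_self) (sub_nonneg.2 h1)
    rw [Finset.sum_range_succ]
    linarith

lemma norm_iterate_sub_le (hη : 0 < η) (hγ : 0 < γ) (w₁ : EuclideanSpace ℝ (Fin d))
    (x : ℕ → EuclideanSpace ℝ (Fin d)) (n : ℕ) : ‖iterate η γ w₁ x n - w₁‖ ≤ η * n := by
  induction n with
  | zero => simp [iterate]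
  | succ n ih =>
    have h0 := sqSum_pos hγ x n
    have h1 : ‖(η / √(sqSum γ x n + ‖x n‖ ^ 2)) • x n‖ ≤ η := by
      rw [norm_smul, Real.norm_of_nonneg (by positivity), div_mul_eq_mul_div]
      refine div_le_of_le_mul₀ (Real.sqrt_nonneg _) hη.le ?_
      gcongr
      exact Real.le_sqrt_of_sq_le (by linarith)
    rw [iterate_succ, sub_right_comm]
    refine (norm_sub_le _ _).trans ?_
    push_cast
    linarith

lemma sqrt_noiseSq_le (h0 : 0 ≤ σ₀) (h1 : 0 ≤ σ₁) (w : EuclideanSpace ℝ (Fin d)) :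
    √(noiseSq f σ₀ σ₁ w) ≤ σ₀ + σ₁ * ‖∇ f w‖ := by
  refine Real.sqrt_le_iff.2 ⟨by positivity, ?_⟩
  unfold noiseSq
  have : 0 ≤ σ₀ * (σ₁ * ‖∇ f w‖) := by positivity
  nlinarith

/-- The stochastic gradients grow at most polynomially in the parameters, so the logarithm of the
accumulator is of the order of `log M`. -/
lemma log_sqSum_div_le (hβ : 0 ≤ β) (h0 : 0 ≤ σ₀) (h1 : 0 ≤ σ₁) (hη : 0 < η) (hγ : 0 < γ)
    (hf : ConvexOn ℝ Set.univ f) (hs : IsSmoothWith β f) (hmin : ∀ y, f z ≤ f y) {T n : ℕ}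
    (hn : n ≤ T) {M : ℝ} (hM6 : 6 ≤ M) (hMT : T ≤ M) (hM0 : σ₀ ≤ M * γ) (hM1 : 1 + σ₁ ≤ M)
    (hMβ : η * β ≤ M * γ) (hMΔ : β * (f w₁ - f z) ≤ M * γ ^ 2)
    (hnoise : ∀ t < T, ‖x t - ∇ f (iterate η γ w₁ x t)‖ ^ 2 ≤
      noiseSq f σ₀ σ₁ (iterate η γ w₁ x t)) :
    Real.log (sqSum γ x n / γ ^ 2) ≤ 10 * Real.log M := by
  have hM0' : 0 < M := by linarith
  have hx : ∀ t < T, ‖x t‖ ≤ M ^ 4 * γ := fun t ht => by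
    set w := iterate η γ w₁ x t with hw
    have h2 : ‖∇ f w₁‖ ≤ 2 * M * γ := by
      refine le_of_sq_le_sq ?_ (by positivity)
      have h3 := norm_gradient_sq_le hβ hf hs hmin w₁
      have h4 : 4 * (M * γ ^ 2) ≤ 4 * (M * (M * γ ^ 2)) := by
        have : 1 * (M * γ ^ 2) ≤ M * (M * γ ^ 2) := by gcongr; linarith
        linarith
      nlinarith
    have h5 : ‖∇ f w‖ ≤ 2 * M * γ + M ^ 2 * γ := by
      have h6 := hs.2 w w₁
      have h7 := norm_iterate_sub_le hη hγ w₁ x t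
      have h8 : (t : ℝ) ≤ M := le_trans (by exact_mod_cast ht.le) hMT
      have h9 : β * ‖w - w₁‖ ≤ M ^ 2 * γ := by
        calc β * ‖w - w₁‖ ≤ β * (η * t) := by gcongr
          _ = η * β * t := by ring
          _ ≤ (M * γ) * M := by gcongr
          _ = _ := by ring
      have h10 := norm_le_norm_add_norm_sub' (∇ f w) (∇ f w₁)
      linarith
    have h11 : ‖x t - ∇ f w‖ ≤ σ₀ + σ₁ * ‖∇ f w‖ :=
      (Real.le_sqrt_of_sq_le (hnoise t ht)).trans (sqrt_noiseSq_le h0 h1 w)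
    have h12 := norm_le_norm_add_norm_sub' (x t) (∇ f w)
    calc ‖x t‖ ≤ (1 + σ₁) * ‖∇ f w‖ + σ₀ := by linarith
      _ ≤ M * (2 * M * γ + M ^ 2 * γ) + M * γ := by gcongr
      _ = (M ^ 3 + 2 * M ^ 2 + M) * γ := by ring
      _ ≤ M ^ 4 * γ := by
        gcongr
        have h13 : 0 ≤ M ^ 2 := by positivity
        have h14 : 0 ≤ M ^ 3 := by positivity
        nlinarith
  have hsum : sqSum γ x n ≤ M ^ 10 * γ ^ 2 := by
    have h2 : ∑ s ∈ Finset.range n, ‖x s‖ ^ 2 ≤ ∑ s ∈ Finset.range n, (M ^ 4 * γ) ^ 2 :=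
      Finset.sum_le_sum fun s hs => by
        have := hx s ((Finset.mem_range.1 hs).trans_le hn)
        gcongr
    rw [Finset.sum_const, Finset.card_range, nsmul_eq_mul] at h2
    have h3 : (n : ℝ) ≤ M := le_trans (by exact_mod_cast hn) hMT
    calc sqSum γ x n ≤ γ ^ 2 + n * (M ^ 4 * γ) ^ 2 := by unfold sqSum; gcongr
      _ ≤ γ ^ 2 + M * (M ^ 4 * γ) ^ 2 := by gcongr
      _ = (1 + M ^ 9) * γ ^ 2 := by ring
      _ ≤ M ^ 10 * γ ^ 2 := by
        gcongr
        have h4 : 1 ≤ M ^ 9 := one_le_pow₀ (by linarith)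
        calc 1 + M ^ 9 ≤ 6 * M ^ 9 := by linarith
          _ ≤ M * M ^ 9 := by gcongr
          _ = _ := by ring
  calc Real.log (sqSum γ x n / γ ^ 2) ≤ Real.log (M ^ 10) := by
        refine Real.log_le_log (div_pos (sqSum_pos hγ x n) (by positivity)) ?_
        rwa [div_le_iff₀ (by positivity)]
    _ = _ := by rw [Real.log_pow]; norm_num

/-- On the event that the supermartingale sums are at most `K`, the optimality gap stays below `F`
along the whole trajectory. This is an induction on time: as long as the gap has not exceeded `F`,
the noise level is at most `σ₀ + σ₁ √(4 β F)`. -/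
lemma gap_le_of_sum_gapInc_le (hβ : 0 < β) (h0 : 0 ≤ σ₀) (h1 : 0 ≤ σ₁) (hη : 0 < η) (hγ : 0 < γ)
    (hf : ConvexOn ℝ Set.univ f) (hs : IsSmoothWith β f) (hmin : ∀ y, f z ≤ f y) {T : ℕ}
    (hnoise : ∀ t < T, ‖x t - ∇ f (iterate η γ w₁ x t)‖ ^ 2 ≤
      noiseSq f σ₀ σ₁ (iterate η γ w₁ x t))
    {F A K L : ℝ} (hL : 1 ≤ L) (hK : K ≤ 4 * L)
    (hlog : ∀ n ≤ T, Real.log (sqSum γ x n / γ ^ 2) ≤ 10 * L)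
    (hA : A = η * σ₀ + η * σ₁ * √(4 * β * F) + β * η ^ 2)
    (hsum : ∀ n ≤ T, ∑ t ∈ Finset.range n,
      gapInc f σ₀ σ₁ η A (iterate η γ w₁ x t) (sqSum γ x t) (x t) ≤ K)
    (hF : 13456 * L ^ 2 * (f w₁ - f z + η * σ₀ + η ^ 2 * β * σ₁ ^ 2 + η ^ 2 * β) ≤ F)
    {n : ℕ} (hn : n ≤ T) : f (iterate η γ w₁ x n) - f z ≤ F := by
  have hΔ : 0 ≤ f w₁ - f z := sub_nonneg.2 (hmin w₁)
  have hF0 : 0 ≤ F := le_trans (by positivity) hF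
  have hA0 : 0 < A := by rw [hA]; positivity
  induction n using Nat.strong_induction_on with
  | _ n ih =>
    have hpath : ∀ m ≤ n, f (iterate η γ w₁ x m) ≤ f w₁ + ∑ t ∈ Finset.range m,
        (2 * A * gapInc f σ₀ σ₁ η A (iterate η γ w₁ x t) (sqSum γ x t) (x t) +
          5 * A * (‖x t‖ ^ 2 / (sqSum γ x t + ‖x t‖ ^ 2))) := fun m hm => by
      induction m with
      | zero => simp [iterate]
      | succ m ihm =>
        have hmT : m < T := by omega
        have h2 := ih m (by omega) hmT.le
        have h3 : η * √(noiseSq f σ₀ σ₁ (iterate η γ w₁ x m)) ≤ A := by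
          have h4 : ‖∇ f (iterate η γ w₁ x m)‖ ≤ √(4 * β * F) := by
            refine Real.le_sqrt_of_sq_le ((norm_gradient_sq_le hβ.le hf hs hmin _).trans ?_)
            gcongr
          calc _ ≤ η * (σ₀ + σ₁ * √(4 * β * F)) := by
                gcongr
                exact (sqrt_noiseSq_le h0 h1 _).trans (by gcongr)
            _ ≤ A := by
              rw [hA]
              have : 0 ≤ β * η ^ 2 := by positivity
              linarith
        have h5 : β * η ^ 2 ≤ A := by
          rw [hA]
          have : 0 ≤ η * σ₀ + η * σ₁ * √(4 * β * F) := by positivity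
          linarith
        have h6 := apply_step_le hη hγ hf hs (sq_le_sqSum γ x m) (hnoise m hmT) hA0 h3 h5
        rw [← iterate_succ] at h6
        rw [Finset.sum_range_succ]
        linarith [ihm (by omega)]
    have h2 := hpath n le_rfl
    rw [Finset.sum_add_distrib, ← Finset.mul_sum, ← Finset.mul_sum] at h2
    have h3 : 2 * A * ∑ t ∈ Finset.range n,
        gapInc f σ₀ σ₁ η A (iterate η γ w₁ x t) (sqSum γ x t) (x t) ≤ 2 * A * (4 * L) := by
      gcongr
      exact (hsum n hn).trans hK
    have h4 : 5 * A * ∑ t ∈ Finset.range n, ‖x t‖ ^ 2 / (sqSum γ x t + ‖x t‖ ^ 2) ≤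
        5 * A * (10 * L) := by
      gcongr
      exact (sum_norm_sq_div_sqSum_le hγ x n).trans (hlog n hn)
    have h5 : f (iterate η γ w₁ x n) - f z ≤ f w₁ - f z + 58 * L * A := by linarith
    -- Young's inequality absorbs the part of `A` that depends on `F`
    have h6 : 58 * L * (η * σ₁ * √(4 * β * F)) ≤ F / 2 + 6728 * L ^ 2 * (η ^ 2 * β * σ₁ ^ 2) := by
      have h7 : √(4 * β * F) = 2 * (√β * √F) := by
        rw [mul_assoc, Real.sqrt_mul (by norm_num), Real.sqrt_mul hβ.le,
          show (4 : ℝ) = 2 ^ 2 by norm_num, Real.sqrt_sq (by norm_num)]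
      have h8 := sq_nonneg (√F - 116 * L * η * σ₁ * √β)
      have h9 := Real.sq_sqrt hF0
      have h10 := Real.sq_sqrt hβ.le
      rw [h7]
      have h11 : (116 * L * η * σ₁ * √β) ^ 2 = 13456 * L ^ 2 * (η ^ 2 * β * σ₁ ^ 2) := by
        rw [← h10, Real.sqrt_sq (Real.sqrt_nonneg _)]; ring
      nlinarith
    have h12 : L ≤ L ^ 2 := by nlinarith
    have h13 : 1 ≤ L ^ 2 := by nlinarith
    have h14 : f w₁ - f z ≤ L ^ 2 * (f w₁ - f z) := le_mul_of_one_le_left hΔ h13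
    have h15 : L * (η * σ₀ + β * η ^ 2) ≤ L ^ 2 * (η * σ₀ + β * η ^ 2) := by gcongr
    have h16 : 0 ≤ L ^ 2 * (f w₁ - f z) := by positivity
    have h17 : 0 ≤ L ^ 2 * (η * σ₀ + β * η ^ 2) := by positivity
    rw [hA] at h5
    linarith

end Trajectory

/-! ### Distance and regret along a trajectory -/

section Bounds

variable {d : ℕ} {f : EuclideanSpace ℝ (Fin d) → ℝ} {β σ₀ σ₁ η γ : ℝ}
  {w₁ z : EuclideanSpace ℝ (Fin d)} {x : ℕ → EuclideanSpace ℝ (Fin d)}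

/-- On the event that the supermartingale sums are at most `K`, and as long as the gap stays below
`F`, the iterates stay within distance `D` of the minimizer, again by induction on time. Here
`R * γ ^ 2` bounds the squared noise level in the region where the gap is at most `F`. -/
lemma norm_iterate_sub_le_of_sum_le (hη : 0 < η) (hγ : 0 < γ)
    (hf : ConvexOn ℝ Set.univ f) (hd : Differentiable ℝ f) (hmin : ∀ y, f z ≤ f y) {T : ℕ}
    (hnoise : ∀ t < T, ‖x t - ∇ f (iterate η γ w₁ x t)‖ ^ 2 ≤
      noiseSq f σ₀ σ₁ (iterate η γ w₁ x t))
    {F D B R K L : ℝ} (hL : 1 ≤ L) (hK : K ≤ 4 * L) (hD : 0 < D) (hR : 0 ≤ R)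
    (hB : B = 2 * (1 + R)) (hN : ∀ w, f w - f z ≤ F → noiseSq f σ₀ σ₁ w ≤ R * γ ^ 2)
    (hlog : ∀ n ≤ T, Real.log (sqSum γ x n / γ ^ 2) ≤ 10 * L)
    (hgap : ∀ n ≤ T, f (iterate η γ w₁ x n) - f z ≤ F)
    (hsum : ∀ n ≤ T, ∑ t ∈ Finset.range n,
      distInc f z D F B (iterate η γ w₁ x t) (sqSum γ x t) (x t) ≤ K)
    (hsum' : ∀ n ≤ T, ∑ t ∈ Finset.range n,
      noiseInc f z F B (iterate η γ w₁ x t) (sqSum γ x t) (x t) ≤ K)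
    (hDle : 160000 * L ^ 2 * (‖w₁ - z‖ ^ 2 + η ^ 2 * (1 + R ^ 2)) ≤ D ^ 2)
    {n : ℕ} (hn : n ≤ T) : ‖iterate η γ w₁ x n - z‖ ≤ D := by
  have hB0 : 0 < B := by linarith
  induction n using Nat.strong_induction_on with
  | _ n ih =>
    have hpath : ∀ m ≤ n, ‖iterate η γ w₁ x m - z‖ ^ 2 ≤ ‖w₁ - z‖ ^ 2 + ∑ t ∈ Finset.range m,
        (8 * D * η * √B * distInc f z D F B (iterate η γ w₁ x t) (sqSum γ x t) (x t) +
          10 * B * η * D * noiseInc f z F B (iterate η γ w₁ x t) (sqSum γ x t) (x t) +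
          (13 * (η * D * (1 + R)) + η ^ 2) * (‖x t‖ ^ 2 / (sqSum γ x t + ‖x t‖ ^ 2))) :=
      fun m hm => by
      induction m with
      | zero => simp [iterate]
      | succ m ihm =>
        have hmT : m < T := by omega
        have h1 := norm_step_sub_sq_le hη hγ hf hd hmin (sq_le_sqSum γ x m)
          ((hnoise m hmT).trans (hN _ (hgap m hmT.le))) hR hB hD (ih m (by omega) hmT.le)
          (hgap m hmT.le)
        rw [← iterate_succ] at h1
        rw [Finset.sum_range_succ]
        linarith [ihm (by omega)]
    have h2 := hpath n le_rfl
    rw [Finset.sum_add_distrib, Finset.sum_add_distrib, ← Finset.mul_sum, ← Finset.mul_sum,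
      ← Finset.mul_sum] at h2
    have hsB : √B ≤ B := Real.sqrt_le_iff.2 ⟨hB0.le, by nlinarith⟩
    have h3 : 8 * D * η * √B * ∑ t ∈ Finset.range n,
        distInc f z D F B (iterate η γ w₁ x t) (sqSum γ x t) (x t) ≤ 8 * D * η * B * (4 * L) :=
      calc _ ≤ 8 * D * η * √B * (4 * L) := by gcongr; exact (hsum n hn).trans hK
        _ ≤ _ := by gcongr
    have h4 : 10 * B * η * D * ∑ t ∈ Finset.range n,
        noiseInc f z F B (iterate η γ w₁ x t) (sqSum γ x t) (x t) ≤ 10 * B * η * D * (4 * L) := by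
      gcongr
      exact (hsum' n hn).trans hK
    have h5 : (13 * (η * D * (1 + R)) + η ^ 2) *
        ∑ t ∈ Finset.range n, ‖x t‖ ^ 2 / (sqSum γ x t + ‖x t‖ ^ 2) ≤
        (13 * (η * D * (1 + R)) + η ^ 2) * (10 * L) := by
      gcongr
      exact (sum_norm_sq_div_sqSum_le hγ x n).trans (hlog n hn)
    have h6 : ‖iterate η γ w₁ x n - z‖ ^ 2 ≤
        ‖w₁ - z‖ ^ 2 + 274 * (η * D * (1 + R) * L) + 10 * η ^ 2 * L := by
      subst hB
      linarith
    have h7 : 274 * (η * D * (1 + R) * L) ≤ D ^ 2 / 2 + 37538 * (η * (1 + R) * L) ^ 2 := by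
      nlinarith [sq_nonneg (D - 274 * (η * (1 + R) * L))]
    have h8 : (η * (1 + R) * L) ^ 2 ≤ 2 * (L ^ 2 * (η ^ 2 * (1 + R ^ 2))) := by
      have : (1 + R) ^ 2 ≤ 2 * (1 + R ^ 2) := by nlinarith [sq_nonneg (1 - R)]
      calc (η * (1 + R) * L) ^ 2 = L ^ 2 * (η ^ 2 * (1 + R) ^ 2) := by ring
        _ ≤ L ^ 2 * (η ^ 2 * (2 * (1 + R ^ 2))) := by gcongr
        _ = _ := by ring
    have h9 : η ^ 2 * L ≤ L ^ 2 * (η ^ 2 * (1 + R ^ 2)) := by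
      calc η ^ 2 * L = L * (η ^ 2 * 1) := by ring
        _ ≤ L ^ 2 * (η ^ 2 * (1 + R ^ 2)) := by gcongr <;> nlinarith
    have h10 : ‖w₁ - z‖ ^ 2 ≤ L ^ 2 * ‖w₁ - z‖ ^ 2 :=
      le_mul_of_one_le_left (sq_nonneg _) (by nlinarith)
    refine le_of_sq_le_sq ?_ hD.le
    have h11 : 0 ≤ L ^ 2 * (η ^ 2 * (1 + R ^ 2)) := by positivity
    have h12 : 0 ≤ L ^ 2 * ‖w₁ - z‖ ^ 2 := by positivity
    linarith

lemma noiseSq_le_of_convex (hβ : 0 ≤ β) (hf : ConvexOn ℝ Set.univ f) (hs : IsSmoothWith β f)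
    (hmin : ∀ y, f z ≤ f y) (w : EuclideanSpace ℝ (Fin d)) :
    noiseSq f σ₀ σ₁ w ≤ σ₀ ^ 2 + 4 * (β * σ₁ ^ 2) * (f w - f z) := by
  have := mul_le_mul_of_nonneg_left (norm_gradient_sq_le hβ hf hs hmin w) (sq_nonneg σ₁)
  unfold noiseSq
  linarith

/-- One step of the regret: the gap is the regret of the stochastic gradient, which telescopes,
plus noise, which is compensated at the price of a fraction of the gap. -/
lemma gap_le_add_regretInc (hβ : 0 < β) (hη : 0 < η) (hγ : 0 < γ)
    (hf : ConvexOn ℝ Set.univ f) (hs : IsSmoothWith β f) (hmin : ∀ y, f z ≤ f y) {D a : ℝ}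
    (ha0 : 0 < a) (ha : a * D ^ 2 * (8 * (β * σ₁ ^ 2)) ≤ 1) {t : ℕ}
    (hdist : ‖iterate η γ w₁ x t - z‖ ≤ D) :
    f (iterate η γ w₁ x t) - f z ≤
      1 / (2 * η) * ((‖iterate η γ w₁ x t - z‖ ^ 2 - ‖iterate η γ w₁ x (t + 1) - z‖ ^ 2) *
        √(sqSum γ x (t + 1))) +
      η / 2 * (‖x t‖ ^ 2 / √(sqSum γ x (t + 1))) +
      1 / a * regretInc f z σ₀ σ₁ a (iterate η γ w₁ x t) (x t) +
      (a * D ^ 2 * σ₀ ^ 2 / 2 + 1 / 4 * (f (iterate η γ w₁ x t) - f z)) := by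
  set w := iterate η γ w₁ x with hw
  have h1 := add_inner_gradient_le hf hs.1 (w t) z
  rw [← neg_sub (w t) z, inner_neg_right] at h1
  have hS : 0 < √(sqSum γ x (t + 1)) := Real.sqrt_pos.2 (sqSum_pos hγ x (t + 1))
  have hwt : w (t + 1) = w t - (η / √(sqSum γ x (t + 1))) • x t := rfl
  have h2 : ‖w (t + 1) - z‖ ^ 2 = ‖w t - z‖ ^ 2 -
      2 * (η / √(sqSum γ x (t + 1)) * inner ℝ (x t) (w t - z)) +
      (η / √(sqSum γ x (t + 1))) ^ 2 * ‖x t‖ ^ 2 := by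
    rw [hwt, sub_right_comm, norm_sub_sq_real, inner_smul_right, norm_smul, mul_pow,
      Real.norm_eq_abs, sq_abs, real_inner_comm]
  have h3 : inner ℝ (x t) (w t - z) =
      1 / (2 * η) * ((‖w t - z‖ ^ 2 - ‖w (t + 1) - z‖ ^ 2) * √(sqSum γ x (t + 1))) +
      η / 2 * (‖x t‖ ^ 2 / √(sqSum γ x (t + 1))) := by
    rw [h2]; field_simp; ring
  have h4 : 1 / a * regretInc f z σ₀ σ₁ a (w t) (x t) =
      inner ℝ (∇ f (w t)) (w t - z) - inner ℝ (x t) (w t - z) -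
        a * (noiseSq f σ₀ σ₁ (w t) * ‖w t - z‖ ^ 2) / 2 := by
    unfold regretInc
    rw [inner_smul_right, inner_sub_left, norm_smul, Real.norm_of_nonneg ha0.le, mul_pow,
      mul_pow, Real.sq_sqrt (noiseSq_nonneg _)]
    field_simp
  have h5 : a * (noiseSq f σ₀ σ₁ (w t) * ‖w t - z‖ ^ 2) / 2 ≤
      a * D ^ 2 * σ₀ ^ 2 / 2 + 1 / 4 * (f (w t) - f z) := by
    have hg := sub_nonneg.2 (hmin (w t))
    have h7 := mul_le_mul_of_nonneg_right ha hg
    have h8 : noiseSq f σ₀ σ₁ (w t) * ‖w t - z‖ ^ 2 ≤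
        (σ₀ ^ 2 + 4 * (β * σ₁ ^ 2) * (f (w t) - f z)) * D ^ 2 :=
      mul_le_mul (noiseSq_le_of_convex hβ.le hf hs hmin (w t)) (by gcongr) (sq_nonneg _) (by positivity)
    have h9 := mul_le_mul_of_nonneg_left h8 ha0.le
    linarith
  linarith

/-- On the event that the supermartingale sum is at most `K`, and as long as the iterates stay
within distance `D` of the minimizer, the regret is bounded. The parameter `a` of the
supermartingale is tuned so that the part of the noise proportional to the gap is absorbed by a
fraction of the regret. -/
lemma sum_gap_le_of_sum_regretInc_le (hβ : 0 < β) (h0 : 0 ≤ σ₀) (hη : 0 < η) (hγ : 0 < γ)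
    (hf : ConvexOn ℝ Set.univ f) (hs : IsSmoothWith β f) (hmin : ∀ y, f z ≤ f y) {T : ℕ}
    (hnoise : ∀ t < T, ‖x t - ∇ f (iterate η γ w₁ x t)‖ ^ 2 ≤
      noiseSq f σ₀ σ₁ (iterate η γ w₁ x t))
    {D K L a : ℝ} (hL : 1 ≤ L) (hK : K ≤ 4 * L) (hD : 0 < D) (hLD : L * η ≤ D)
    (ha : a = 1 / (8 * D ^ 2 * (β * (1 + σ₁ ^ 2)) + D * σ₀ * √T))
    (hdist : ∀ t ≤ T, ‖iterate η γ w₁ x t - z‖ ≤ D)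
    (hsum : ∑ t ∈ Finset.range T, regretInc f z σ₀ σ₁ a (iterate η γ w₁ x t) (x t) ≤ K) :
    ∑ t ∈ Finset.range T, (f (iterate η γ w₁ x t) - f z) ≤
      γ * ‖w₁ - z‖ ^ 2 / η + 13 * (D ^ 2 / η + η) * σ₀ * √T +
        80 * (D ^ 2 / η + η) ^ 2 * (β * (1 + σ₁ ^ 2)) := by
  set w := iterate η γ w₁ x with hw
  set Rg := ∑ t ∈ Finset.range T, (f (w t) - f z) with hRg
  set b := β * (1 + σ₁ ^ 2) with hb
  set E := D ^ 2 / η + η with hE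
  have hRg0 : 0 ≤ Rg := Finset.sum_nonneg fun t _ => sub_nonneg.2 (hmin _)
  have hb0 : 0 < b := by positivity
  have hE0 : 0 < E := by positivity
  have hT0 : 0 ≤ √(T : ℝ) := Real.sqrt_nonneg _
  have hTsq : √(T : ℝ) ^ 2 = T := Real.sq_sqrt (Nat.cast_nonneg T)
  have hden : 0 < 8 * D ^ 2 * b + D * σ₀ * √T := by positivity
  have ha0 : 0 < a := by rw [ha]; positivity
  have hgrad : ∀ t, ‖∇ f (w t)‖ ^ 2 ≤ 4 * β * (f (w t) - f z) := fun t =>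
    norm_gradient_sq_le hβ.le hf hs hmin (w t)
  have hnoise' : ∀ t, noiseSq f σ₀ σ₁ (w t) ≤ σ₀ ^ 2 + 4 * (β * σ₁ ^ 2) * (f (w t) - f z) :=
    fun t => noiseSq_le_of_convex hβ.le hf hs hmin (w t)
  have ha8 : a * D ^ 2 * (8 * (β * σ₁ ^ 2)) ≤ 1 := by
    rw [ha, one_div_mul_eq_div, div_mul_eq_mul_div, div_le_one hden, hb]
    have : 0 ≤ D * σ₀ * √T := by positivity
    have : 0 ≤ D ^ 2 * β := by positivity
    linarith
  have h1 := Finset.sum_le_sum fun t (ht : t ∈ Finset.range T) =>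
    gap_le_add_regretInc (σ₀ := σ₀) hβ hη hγ hf hs hmin ha0 ha8 (hdist t (Finset.mem_range.1 ht).le)
  simp only [Finset.sum_add_distrib, ← Finset.mul_sum, Finset.sum_const, Finset.card_range,
    nsmul_eq_mul] at h1
  rw [← hRg] at h1
  set Q := √(sqSum γ x T) - γ with hQ
  have hQ0 : 0 ≤ Q := sub_nonneg.2 (Real.le_sqrt_of_sq_le (sq_le_sqSum γ x T))
  have h2 := sum_sub_mul_sqrt_sqSum_le (r := fun t => ‖w t - z‖ ^ 2) hγ x (Q := D ^ 2) (n := T)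
    fun t ht => by gcongr; exact hdist t ht.le
  have h3 := sum_norm_sq_div_sqrt_sqSum_le hγ x T
  have h2' := mul_le_mul_of_nonneg_left h2 (by positivity : 0 ≤ 1 / (2 * η))
  have h3' := mul_le_mul_of_nonneg_left h3 (by positivity : 0 ≤ η / 2)
  have h4 : 1 / a * ∑ t ∈ Finset.range T, regretInc f z σ₀ σ₁ a (w t) (x t) ≤
      32 * E ^ 2 * b + 4 * (E * σ₀ * √T) := by
    have h5 : 1 / a * ∑ t ∈ Finset.range T, regretInc f z σ₀ σ₁ a (w t) (x t) ≤
        1 / a * (4 * L) := by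
      gcongr
      exact hsum.trans hK
    have h6 : D * L ≤ E := by
      have h7 : D * L ≤ D ^ 2 / η := by
        rw [le_div_iff₀ hη, mul_assoc, sq]
        exact mul_le_mul_of_nonneg_left hLD hD.le
      linarith
    have h8 : D ^ 2 * L ≤ E ^ 2 := by
      calc D ^ 2 * L ≤ (D * L) ^ 2 := by
            have : L ≤ L ^ 2 := by nlinarith
            rw [mul_pow]; gcongr
        _ ≤ E ^ 2 := by gcongr
    have h9 : 1 / a = 8 * D ^ 2 * b + D * σ₀ * √T := by rw [ha, one_div_one_div]
    calc _ ≤ _ := h5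
      _ = 32 * (D ^ 2 * L) * b + 4 * ((D * L) * σ₀ * √T) := by rw [h9]; ring
      _ ≤ _ := by gcongr
  have h5 : (T : ℝ) * (a * D ^ 2 * σ₀ ^ 2 / 2) ≤ E * σ₀ * √T / 2 := by
    have h6 : a * (D * σ₀ * √T) ≤ 1 := by
      rw [ha, one_div_mul_eq_div, div_le_one hden]
      have : 0 ≤ D ^ 2 * b := by positivity
      linarith
    have h7 : D ≤ E := by
      have h8 : D ≤ D ^ 2 / η := by
        rw [le_div_iff₀ hη, sq]
        exact mul_le_mul_of_nonneg_left ((le_mul_of_one_le_left hη.le hL).trans hLD) hD.le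
      linarith
    calc (T : ℝ) * (a * D ^ 2 * σ₀ ^ 2 / 2) = √T ^ 2 * (a * D ^ 2 * σ₀ ^ 2 / 2) := by rw [hTsq]
      _ = a * (D * σ₀ * √T) * (D * σ₀ * √T) / 2 := by ring
      _ ≤ 1 * (E * σ₀ * √T) / 2 := by gcongr
      _ = _ := by ring
  -- self-bounding: the accumulator is controlled by the regret itself
  have hacc : Q ^ 2 ≤ 2 * σ₀ ^ 2 * T + 8 * b * Rg := by
    have h6 : ∀ t ∈ Finset.range T, ‖x t‖ ^ 2 ≤ 2 * σ₀ ^ 2 + 8 * b * (f (w t) - f z) :=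
      fun t ht => by
        have h7 := norm_le_norm_add_norm_sub' (x t) (∇ f (w t))
        have h8 : ‖x t‖ ^ 2 ≤ (‖∇ f (w t)‖ + ‖x t - ∇ f (w t)‖) ^ 2 := by gcongr
        have h9 := (hnoise t (Finset.mem_range.1 ht)).trans (hnoise' t)
        have h10 := hgrad t
        have h11 := sq_nonneg (‖∇ f (w t)‖ - ‖x t - ∇ f (w t)‖)
        have h12 : 2 * ‖∇ f (w t)‖ ^ 2 ≤ 8 * β * (f (w t) - f z) := by linarith
        calc ‖x t‖ ^ 2 ≤ 2 * ‖∇ f (w t)‖ ^ 2 + 2 * ‖x t - ∇ f (w t)‖ ^ 2 := by linarith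
          _ ≤ 8 * β * (f (w t) - f z) + 2 * (σ₀ ^ 2 + 4 * (β * σ₁ ^ 2) * (f (w t) - f z)) :=
            add_le_add h12 (by linarith)
          _ = _ := by rw [hb]; ring
    have h7 := Finset.sum_le_sum h6
    simp only [Finset.sum_add_distrib, ← Finset.mul_sum, Finset.sum_const, Finset.card_range,
      nsmul_eq_mul] at h7
    rw [← hRg] at h7
    have h8 : √(sqSum γ x T) ^ 2 = γ ^ 2 + ∑ t ∈ Finset.range T, ‖x t‖ ^ 2 :=
      Real.sq_sqrt (sqSum_pos hγ x T).le
    have h9 : √(sqSum γ x T) = Q + γ := by rw [hQ]; ring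
    rw [h9] at h8
    have h10 : 0 ≤ Q * γ := by positivity
    linarith
  have hEQ : E * Q ≤ 2 * (E * σ₀ * √T) + Rg / 4 + 8 * E ^ 2 * b := by
    refine le_of_sq_le_sq ?_ (by positivity)
    have h6 := mul_le_mul_of_nonneg_left hacc (sq_nonneg E)
    rw [← hTsq] at h6
    have h7 : 0 ≤ E * σ₀ * √T := by positivity
    have h8 : 0 ≤ E * σ₀ * √T * (Rg / 4 + 8 * E ^ 2 * b) := by positivity
    linarith [sq_nonneg (Rg / 4 - 8 * E ^ 2 * b), sq_nonneg (E * σ₀ * √T)]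
  have h6 : 1 / (2 * η) * (γ * ‖w 0 - z‖ ^ 2 + D ^ 2 * Q - ‖w T - z‖ ^ 2 * √(sqSum γ x T)) +
      η / 2 * (2 * Q) ≤ γ * ‖w₁ - z‖ ^ 2 / η / 2 + E * Q := by
    have h7 : 0 ≤ ‖w T - z‖ ^ 2 * √(sqSum γ x T) / (2 * η) := by positivity
    have h8 : 0 ≤ D ^ 2 / η * Q / 2 := by positivity
    have h9 : 1 / (2 * η) * (γ * ‖w 0 - z‖ ^ 2 + D ^ 2 * Q - ‖w T - z‖ ^ 2 * √(sqSum γ x T)) =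
      γ * ‖w₁ - z‖ ^ 2 / η / 2 + D ^ 2 / η * Q / 2 -
        ‖w T - z‖ ^ 2 * √(sqSum γ x T) / (2 * η) := by
      have : w 0 = w₁ := rfl
      rw [this]; field_simp
    rw [h9, hE]
    linarith
  have h7 : 0 ≤ E * σ₀ * √T := by positivity
  linarith

end Bounds

/-! ### Conclusion -/

/-- Union bound over four events of probability `δ / 4` and a null event. -/
lemma ofReal_one_sub_le_measure {Ω : Type*} [MeasurableSpace Ω] {P : Measure Ω}
    [IsProbabilityMeasure P] {δ : ℝ} (hδ : 0 ≤ δ) {G B₀ B₁ B₂ B₃ B₄ : Set Ω} (h₀ : P B₀ = 0)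
    (h₁ : P B₁ ≤ ENNReal.ofReal (δ / 4)) (h₂ : P B₂ ≤ ENNReal.ofReal (δ / 4))
    (h₃ : P B₃ ≤ ENNReal.ofReal (δ / 4)) (h₄ : P B₄ ≤ ENNReal.ofReal (δ / 4))
    (hG : ∀ ω, ω ∉ B₀ → ω ∉ B₁ → ω ∉ B₂ → ω ∉ B₃ → ω ∉ B₄ → ω ∈ G) :
    ENNReal.ofReal (1 - δ) ≤ P G := by
  have hcover : (Set.univ : Set Ω) ⊆ G ∪ (B₀ ∪ (B₁ ∪ B₂ ∪ (B₃ ∪ B₄))) := by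
    intro ω _
    by_contra hω
    simp only [Set.mem_union, not_or] at hω
    obtain ⟨hg, h0, ⟨h1, h2⟩, h3, h4⟩ := hω
    exact hg (hG ω h0 h1 h2 h3 h4)
  have hbad : P (B₀ ∪ (B₁ ∪ B₂ ∪ (B₃ ∪ B₄))) ≤ ENNReal.ofReal δ := by
    refine (measure_union_le _ _).trans ?_
    rw [h₀, zero_add]
    have h4 : (0 : ℝ) ≤ δ / 4 := by positivity
    calc P (B₁ ∪ B₂ ∪ (B₃ ∪ B₄)) ≤ (P B₁ + P B₂) + (P B₃ + P B₄) :=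
          (measure_union_le _ _).trans (add_le_add (measure_union_le _ _) (measure_union_le _ _))
      _ ≤ (ENNReal.ofReal (δ / 4) + ENNReal.ofReal (δ / 4)) +
          (ENNReal.ofReal (δ / 4) + ENNReal.ofReal (δ / 4)) := by gcongr
      _ = ENNReal.ofReal δ := by
        rw [← ENNReal.ofReal_add h4 h4, ← ENNReal.ofReal_add (by positivity) (by positivity)]
        congr 1
        ring
  rw [ENNReal.ofReal_sub _ hδ, ENNReal.ofReal_one]
  refine tsub_le_iff_right.2 ?_
  calc (1 : ENNReal) = P Set.univ := measure_univ.symm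
    _ ≤ P G + P (B₀ ∪ (B₁ ∪ B₂ ∪ (B₃ ∪ B₄))) :=
      (measure_mono hcover).trans (measure_union_le _ _)
    _ ≤ _ := by gcongr

section Conclusion

variable {d : ℕ} {f : EuclideanSpace ℝ (Fin d) → ℝ} {β σ₀ σ₁ η γ δ : ℝ}
  {w₁ z : EuclideanSpace ℝ (Fin d)} {x : ℕ → EuclideanSpace ℝ (Fin d)}

lemma le_of_gradient_eq_zero (hf : ConvexOn ℝ Set.univ f) (hd : Differentiable ℝ f)
    {w : EuclideanSpace ℝ (Fin d)} (hw : ∇ f w = 0) (y : EuclideanSpace ℝ (Fin d)) :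
    f w ≤ f y := by
  have := add_inner_gradient_le hf hd w y
  simpa [hw] using this

lemma apply_eq_of_isSmoothWith_zero (hf : ConvexOn ℝ Set.univ f) (hs : IsSmoothWith 0 f)
    (hmin : ∀ y, f z ≤ f y) (w : EuclideanSpace ℝ (Fin d)) : f w = f z := by
  refine le_antisymm (le_of_gradient_eq_zero hf hs.1 ?_ z) (hmin w)
  have h := norm_gradient_sq_le le_rfl hf hs hmin w
  simpa using h

/-- Jensen's inequality for the average of the iterates. -/
lemma apply_average_sub_le (hf : ConvexOn ℝ Set.univ f) {T : ℕ} (hT : 1 ≤ T)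
    (w : ℕ → EuclideanSpace ℝ (Fin d)) :
    f ((1 / (T : ℝ)) • ∑ t ∈ Finset.range T, w t) - f z ≤
      (∑ t ∈ Finset.range T, (f (w t) - f z)) * (1 / (T : ℝ)) := by
  have hT0 : (0 : ℝ) < T := by exact_mod_cast hT
  have h := hf.map_sum_le (t := Finset.range T) (w := fun _ => 1 / (T : ℝ)) (p := w)
    (fun _ _ => by positivity) (by simp [hT0.ne']) (fun _ _ => Set.mem_univ _)
  rw [← Finset.smul_sum] at h
  simp only [smul_eq_mul, ← Finset.mul_sum] at h
  rw [Finset.sum_sub_distrib, sub_mul, Finset.sum_const, Finset.card_range, nsmul_eq_mul]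
  have h2 : (T : ℝ) * f z * (1 / (T : ℝ)) = f z := by field_simp
  linarith

lemma one_le_logFactor {T : ℕ} {Δ : ℝ} (hβ : 0 ≤ β) (h0 : 0 ≤ σ₀) (h1 : 0 ≤ σ₁) (hη : 0 < η)
    (hγ : 0 < γ) (hδ : 0 < δ) (hΔ : 0 ≤ Δ) : 1 ≤ logFactor T δ β σ₀ σ₁ η γ Δ := by
  unfold logFactor
  rw [Real.le_logb_iff_rpow_le one_lt_two (by positivity), Real.rpow_one]
  have : 0 ≤ T / δ + σ₀ / γ + σ₁ + η * β / γ + β * Δ / γ ^ 2 := by positivity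
  linarith

lemma log_le_logb_two {M : ℝ} (hM : 1 ≤ M) : Real.log M ≤ Real.logb 2 M := by
  unfold Real.logb
  rw [le_div_iff₀ (Real.log_pos one_lt_two)]
  exact mul_le_of_le_one_right (Real.log_nonneg hM) (by linarith [Real.log_two_lt_d9])

lemma log_eight_mul_div_le {T : ℕ} {Δ : ℝ} (hβ : 0 ≤ β) (h0 : 0 ≤ σ₀) (h1 : 0 ≤ σ₁) (hη : 0 < η)
    (hγ : 0 < γ) (hδ : 0 < δ) (hΔ : 0 ≤ Δ) (hT : 1 ≤ T) :
    Real.log (8 * T / δ) ≤ 4 * logFactor T δ β σ₀ σ₁ η γ Δ := by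
  have hL := one_le_logFactor (T := T) hβ h0 h1 hη hγ hδ hΔ
  have hT0 : (0 : ℝ) < T := by exact_mod_cast hT
  have h8 : Real.log 8 ≤ 3 := by
    rw [show (8 : ℝ) = 2 ^ 3 by norm_num, Real.log_pow]
    push_cast
    linarith [Real.log_two_lt_d9]
  have hM : Real.log (T / δ) ≤ logFactor T δ β σ₀ σ₁ η γ Δ := by
    have h2 : 0 ≤ σ₀ / γ + σ₁ + η * β / γ + β * Δ / γ ^ 2 := by positivity
    have h3 : 0 < T / δ := by positivity
    unfold logFactor
    exact (Real.log_le_log h3 (by linarith)).trans (log_le_logb_two (by linarith))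
  rw [mul_div_assoc, Real.log_mul (by norm_num) (by positivity)]
  linarith

lemma log_sqSum_div_le_logFactor (hβ : 0 ≤ β) (h0 : 0 ≤ σ₀) (h1 : 0 ≤ σ₁) (hη : 0 < η)
    (hγ : 0 < γ) (hf : ConvexOn ℝ Set.univ f) (hs : IsSmoothWith β f) (hmin : ∀ y, f z ≤ f y)
    (hδ : 0 < δ) (hδ4 : δ < 1 / 4) {T n : ℕ} (hT : 1 ≤ T) (hn : n ≤ T)
    (hnoise : ∀ t < T, ‖x t - ∇ f (iterate η γ w₁ x t)‖ ^ 2 ≤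
      noiseSq f σ₀ σ₁ (iterate η γ w₁ x t)) :
    Real.log (sqSum γ x n / γ ^ 2) ≤ 10 * logFactor T δ β σ₀ σ₁ η γ (f w₁ - f z) := by
  have hΔ : 0 ≤ f w₁ - f z := sub_nonneg.2 (hmin w₁)
  have hT1 : (1 : ℝ) ≤ T := by exact_mod_cast hT
  have e1 : 4 * (T : ℝ) ≤ T / δ := by
    rw [le_div_iff₀ hδ]; nlinarith
  have e2 : 0 ≤ σ₀ / γ := by positivity
  have e3 : 0 ≤ η * β / γ := by positivity
  have e4 : 0 ≤ β * (f w₁ - f z) / γ ^ 2 := by positivity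
  unfold logFactor
  set M := 2 + T / δ + σ₀ / γ + σ₁ + η * β / γ + β * (f w₁ - f z) / γ ^ 2 with hM
  have h2 := log_sqSum_div_le (M := M) hβ h0 h1 hη hγ hf hs hmin hn (by linarith) (by linarith)
    ((div_le_iff₀ hγ).1 (by linarith)) (by linarith) ((div_le_iff₀ hγ).1 (by linarith))
    ((div_le_iff₀ (by positivity)).1 (by linarith)) hnoise
  linarith [log_le_logb_two (M := M) (by linarith)]

/-- The conclusion on the event that the noise bound holds along the run and that the four
supermartingale sums are at most `log (8 * T / δ)`. -/
lemma conclusion_of_sum_le (hβ : 0 ≤ β) (h0 : 0 ≤ σ₀) (h1 : 0 ≤ σ₁) (hη : 0 < η)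
    (hγ : 0 < γ) (hf : ConvexOn ℝ Set.univ f) (hs : IsSmoothWith β f) (hmin : ∀ y, f z ≤ f y)
    (hδ : 0 < δ) (hδ4 : δ < 1 / 4) {T : ℕ} (hT : 1 ≤ T)
    (hnoise : ∀ t < T, ‖x t - ∇ f (iterate η γ w₁ x t)‖ ^ 2 ≤
      noiseSq f σ₀ σ₁ (iterate η γ w₁ x t))
    {c L F D R : ℝ} (hc : c = 10 ^ 7) (hL : L = logFactor T δ β σ₀ σ₁ η γ (f w₁ - f z))
    (hF : F = gapBound c 2 L β σ₀ σ₁ η (f w₁ - f z)) (hD0 : 0 < D)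
    (hD : D ^ 2 = sqDistBound c 2 L β σ₀ σ₁ η γ ‖w₁ - z‖ F)
    (hR : R = (σ₀ ^ 2 + 4 * (β * σ₁ ^ 2) * F) / γ ^ 2)
    {a : ℝ} (ha : a = 1 / (8 * D ^ 2 * (β * (1 + σ₁ ^ 2)) + D * σ₀ * √T))
    (hgap : ∀ n ≤ T, ∑ t ∈ Finset.range n,
      gapInc f σ₀ σ₁ η (η * σ₀ + η * σ₁ * √(4 * β * F) + β * η ^ 2) (iterate η γ w₁ x t)
        (sqSum γ x t) (x t) ≤ Real.log (8 * T / δ))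
    (hdist : ∀ n ≤ T, ∑ t ∈ Finset.range n,
      distInc f z D F (2 * (1 + R)) (iterate η γ w₁ x t) (sqSum γ x t) (x t) ≤
        Real.log (8 * T / δ))
    (hnoi : ∀ n ≤ T, ∑ t ∈ Finset.range n,
      noiseInc f z F (2 * (1 + R)) (iterate η γ w₁ x t) (sqSum γ x t) (x t) ≤
        Real.log (8 * T / δ))
    (hreg : ∑ t ∈ Finset.range T, regretInc f z σ₀ σ₁ a (iterate η γ w₁ x t) (x t) ≤
      Real.log (8 * T / δ)) :
    f ((1 / (T : ℝ)) • ∑ t ∈ Finset.range T, iterate η γ w₁ x t) - f z ≤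
      c * ((D ^ 2 / η + η) + D * √(Real.logb 2 (1 / δ))) * (σ₀ / √(T : ℝ))
        + c * (γ * ‖w₁ - z‖ ^ 2 / η + β * (1 + σ₁ ^ 2) * (D ^ 2 / η + η) ^ 2
          + β * σ₁ ^ 2 * D ^ 2 * Real.logb 2 (1 / δ)) * (1 / (T : ℝ)) ∧
    ∀ t ≤ T, ‖iterate η γ w₁ x t - z‖ ≤ D := by
  have hΔ : 0 ≤ f w₁ - f z := sub_nonneg.2 (hmin w₁)
  have hL1 : 1 ≤ L := hL ▸ one_le_logFactor hβ h0 h1 hη hγ hδ hΔ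
  have hK : Real.log (8 * T / δ) ≤ 4 * L := hL ▸ log_eight_mul_div_le hβ h0 h1 hη hγ hδ hΔ hT
  have hlog : ∀ n ≤ T, Real.log (sqSum γ x n / γ ^ 2) ≤ 10 * L := fun n hn =>
    hL ▸ log_sqSum_div_le_logFactor hβ h0 h1 hη hγ hf hs hmin hδ hδ4 hT hn hnoise
  unfold gapBound at hF
  unfold sqDistBound at hD
  have hF0 : 0 ≤ F := by rw [hF, hc]; positivity
  have hR0 : 0 ≤ R := by rw [hR]; positivity
  have hN : ∀ w, f w - f z ≤ F → noiseSq f σ₀ σ₁ w ≤ R * γ ^ 2 := fun w hw => by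
    rw [hR, div_mul_cancel₀ _ (by positivity)]
    refine (noiseSq_le_of_convex hβ hf hs hmin w).trans ?_
    gcongr
  have hgapF : ∀ n ≤ T, f (iterate η γ w₁ x n) - f z ≤ F := fun n hn => by
    rcases hβ.eq_or_lt with hβ0 | hβ
    · subst hβ0
      rw [apply_eq_of_isSmoothWith_zero hf hs hmin, sub_self]
      exact hF0
    · refine gap_le_of_sum_gapInc_le hβ h0 h1 hη hγ hf hs hmin hnoise hL1 hK hlog rfl hgap ?_ hn
      rw [hF, hc]
      gcongr
      norm_num
  have hR2 : R ^ 2 ≤ 32 * ((σ₀ ^ 4 + β ^ 2 * σ₁ ^ 4 * F ^ 2) / γ ^ 4) := by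
    rw [hR, div_pow, ← pow_mul, ← mul_div_assoc]
    refine div_le_div_of_nonneg_right ?_ (by positivity)
    nlinarith [sq_nonneg (σ₀ ^ 2 - 4 * (β * σ₁ ^ 2) * F), sq_nonneg (σ₀ ^ 2)]
  have hDle : 160000 * L ^ 2 * (‖w₁ - z‖ ^ 2 + η ^ 2 * (1 + R ^ 2)) ≤ D ^ 2 := by
    have h2 : 0 ≤ (σ₀ ^ 2 + β * σ₁ ^ 2 * F) / γ ^ 2 := by positivity
    have h4 : 1 + R ^ 2 ≤ 32 * (1 + σ₁ ^ 2 + (σ₀ ^ 2 + β * σ₁ ^ 2 * F) / γ ^ 2 +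
        (σ₀ ^ 4 + β ^ 2 * σ₁ ^ 4 * F ^ 2) / γ ^ 4) := by linarith [sq_nonneg σ₁]
    have h5 := mul_le_mul_of_nonneg_left h4 (sq_nonneg η)
    rw [hD]
    set V := ‖w₁ - z‖ ^ 2 + η ^ 2 * (1 + σ₁ ^ 2 + (σ₀ ^ 2 + β * σ₁ ^ 2 * F) / γ ^ 2 +
      (σ₀ ^ 4 + β ^ 2 * σ₁ ^ 4 * F ^ 2) / γ ^ 4) with hV
    have hV0 : 0 ≤ V := by positivity
    have h3 : ‖w₁ - z‖ ^ 2 + η ^ 2 * (1 + R ^ 2) ≤ 32 * V := by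
      rw [hV]
      linarith [sq_nonneg ‖w₁ - z‖]
    calc 160000 * L ^ 2 * (‖w₁ - z‖ ^ 2 + η ^ 2 * (1 + R ^ 2))
        ≤ 160000 * L ^ 2 * (32 * V) := by gcongr
      _ = 5120000 * L ^ 2 * V := by ring
      _ ≤ c * L ^ 2 * V := by
        rw [hc]
        gcongr
        norm_num
  have hdistD : ∀ t ≤ T, ‖iterate η γ w₁ x t - z‖ ≤ D := fun t ht =>
    norm_iterate_sub_le_of_sum_le hη hγ hf hs.1 hmin hnoise hL1 hK hD0 hR0 rfl hN hlog hgapF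
      hdist hnoi hDle ht
  refine ⟨?_, hdistD⟩
  have hT0 : (0 : ℝ) < T := by exact_mod_cast hT
  have hlogδ : 0 ≤ Real.logb 2 (1 / δ) := by
    refine Real.logb_nonneg one_lt_two ?_
    rw [le_div_iff₀ hδ]
    linarith
  refine (apply_average_sub_le hf hT _).trans ?_
  have hc0 : 0 < c := by rw [hc]; norm_num
  have hc80 : 80 ≤ c := by rw [hc]; norm_num
  rcases hβ.eq_or_lt with hβ0 | hβ
  · subst hβ0
    simp only [apply_eq_of_isSmoothWith_zero hf hs hmin, sub_self, Finset.sum_const_zero, zero_mul]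
    positivity
  have hLD : L * η ≤ D := by
    refine le_of_sq_le_sq ?_ hD0.le
    refine le_trans ?_ hDle
    have h2 : 0 ≤ L ^ 2 * ‖w₁ - z‖ ^ 2 := by positivity
    have h3 : 0 ≤ L ^ 2 * η ^ 2 := by positivity
    have h4 : 0 ≤ L ^ 2 * (η ^ 2 * R ^ 2) := by positivity
    linarith
  have h2 := sum_gap_le_of_sum_regretInc_le hβ h0 hη hγ hf hs hmin hnoise hL1 hK hD0 hLD ha
    hdistD hreg
  calc _ ≤ _ * (1 / (T : ℝ)) := mul_le_mul_of_nonneg_right h2 (by positivity)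
    _ = 13 * (D ^ 2 / η + η) * (σ₀ / √T) + (γ * ‖w₁ - z‖ ^ 2 / η +
        80 * (D ^ 2 / η + η) ^ 2 * (β * (1 + σ₁ ^ 2))) * (1 / (T : ℝ)) := by
      have h3 : √(T : ℝ) * (1 / (T : ℝ)) = 1 / √T := by
        rw [mul_one_div, Real.sqrt_div_self', one_div]
      have h4 : σ₀ / √(T : ℝ) = σ₀ * (√(T : ℝ) * (1 / (T : ℝ))) := by rw [h3, mul_one_div]
      rw [h4]
      ring
    _ ≤ _ := by
      have h3 : 0 ≤ D * √(Real.logb 2 (1 / δ)) := by positivity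
      have h4 : 0 ≤ D ^ 2 / η + η := by positivity
      have h5 : 0 ≤ γ * ‖w₁ - z‖ ^ 2 / η := by positivity
      have h6 : 0 ≤ β * σ₁ ^ 2 * D ^ 2 * Real.logb 2 (1 / δ) := by positivity
      have h7 : 0 ≤ (D ^ 2 / η + η) ^ 2 * (β * (1 + σ₁ ^ 2)) := by positivity
      refine add_le_add (mul_le_mul_of_nonneg_right ?_ (by positivity))
        (mul_le_mul_of_nonneg_right ?_ (by positivity))
      · have := mul_le_mul_of_nonneg_right hc80 h4
        have := mul_nonneg hc0.le h3
        linarith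
      · have := mul_le_mul_of_nonneg_right hc80 h7
        have := mul_le_mul_of_nonneg_right hc80 h5
        have := mul_nonneg hc0.le h6
        linarith

end Conclusion

end AdaGradNorm

theorem theorem2 :
    -- `c` and `p` are universal: they are chosen before all the data of the problem.
    ∃ (c : ℝ) (p : ℕ), 0 < c ∧
      ∀ (d : ℕ) (f : EuclideanSpace ℝ (Fin d) → ℝ) (β σ₀ σ₁ η γ δ : ℝ) (T : ℕ)
        (w₁ wstar : EuclideanSpace ℝ (Fin d))
        (κ : Kernel (EuclideanSpace ℝ (Fin d)) (EuclideanSpace ℝ (Fin d)))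
        (Ω : Type*) [MeasurableSpace Ω] (P : Measure Ω) [IsProbabilityMeasure P]
        (g : ℕ → Ω → EuclideanSpace ℝ (Fin d)),
        0 ≤ β → 0 ≤ σ₀ → 0 ≤ σ₁ → 0 < η → 0 < γ → 0 < δ → δ < 1 / 4 → 1 ≤ T →
        ConvexOn ℝ Set.univ f →
        AdaGradNorm.IsSmoothWith β f →
        (∀ w, f wstar ≤ f w) →
        AdaGradNorm.IsAffineNoiseOracle f σ₀ σ₁ κ →
        AdaGradNorm.IsRun P κ η γ w₁ T g →
        ∀ (d₁ L F D : ℝ),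
          d₁ = ‖w₁ - wstar‖ →
          L = AdaGradNorm.logFactor T δ β σ₀ σ₁ η γ (f w₁ - f wstar) →
          F = AdaGradNorm.gapBound c p L β σ₀ σ₁ η (f w₁ - f wstar) →
          D = √(AdaGradNorm.sqDistBound c p L β σ₀ σ₁ η γ d₁ F) →
          ENNReal.ofReal (1 - δ) ≤ P {ω |
            f ((1 / (T : ℝ)) • ∑ t ∈ Finset.range T,
                AdaGradNorm.iterate η γ w₁ (fun s => g s ω) t) - f wstar
              ≤ c * ((D ^ 2 / η + η) + D * √(Real.logb 2 (1 / δ))) * (σ₀ / √(T : ℝ))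
                + c * (γ * d₁ ^ 2 / η + β * (1 + σ₁ ^ 2) * (D ^ 2 / η + η) ^ 2
                    + β * σ₁ ^ 2 * D ^ 2 * Real.logb 2 (1 / δ)) * (1 / (T : ℝ))
            ∧ ∀ t ≤ T, ‖AdaGradNorm.iterate η γ w₁ (fun s => g s ω) t - wstar‖ ≤ D} := by
  -- the distance bound needs `c ≥ 32 * 160000`, the other two bounds much less
  obtain ⟨c, hc⟩ : ∃ c : ℝ, c = 10 ^ 7 := ⟨_, rfl⟩
  have hc0 : 0 < c := by rw [hc]; norm_num
  refine ⟨c, 2, hc0, ?_⟩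
  intro d f β σ₀ σ₁ η γ δ T w₁ z κ Ω _ P _ g hβ h0 h1 hη hγ hδ hδ4 hT hf hs hmin hκ hrun
    d₁ L F D hd₁ hL hF hD
  have := hκ.markov
  subst hd₁
  have hΔ : 0 ≤ f w₁ - f z := sub_nonneg.2 (hmin w₁)
  have hL1 : 1 ≤ L := hL ▸ AdaGradNorm.one_le_logFactor hβ h0 h1 hη hγ hδ hΔ
  have hF0 : 0 ≤ F := by
    rw [hF, AdaGradNorm.gapBound]
    positivity
  have hpos : 0 < AdaGradNorm.sqDistBound c 2 L β σ₀ σ₁ η γ ‖w₁ - z‖ F := by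
    unfold AdaGradNorm.sqDistBound
    positivity
  have hD0 : 0 < D := hD ▸ Real.sqrt_pos.2 hpos
  have hD2 : D ^ 2 = AdaGradNorm.sqDistBound c 2 L β σ₀ σ₁ η γ ‖w₁ - z‖ F := by
    rw [hD, Real.sq_sqrt hpos.le]
  obtain ⟨R, hR⟩ : ∃ R, R = (σ₀ ^ 2 + 4 * (β * σ₁ ^ 2) * F) / γ ^ 2 := ⟨_, rfl⟩
  obtain ⟨a, ha⟩ : ∃ a, a = 1 / (8 * D ^ 2 * (β * (1 + σ₁ ^ 2)) + D * σ₀ * √(T : ℝ)) := ⟨_, rfl⟩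
  have hR0 : 0 ≤ R := by rw [hR]; positivity
  have hN : ∀ w, f w - f z ≤ F → AdaGradNorm.noiseSq f σ₀ σ₁ w ≤ R * γ ^ 2 := fun w hw => by
    rw [hR, div_mul_cancel₀ _ (by positivity)]
    refine (AdaGradNorm.noiseSq_le_of_convex hβ hf hs hmin w).trans ?_
    gcongr
  -- each of the four supermartingales exceeds its threshold with probability at most `δ / 4`
  have hP1 := hrun.measure_sum_gt_le
    (φ := AdaGradNorm.gapInc f σ₀ σ₁ η (η * σ₀ + η * σ₁ * √(4 * β * F) + β * η ^ 2))
    (AdaGradNorm.measurable_gapInc hs _) (fun w S _ => hκ.lintegral_exp_gapInc_le _ w S) hδ hT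
  have hP2 := hrun.measure_sum_gt_le (φ := AdaGradNorm.distInc f z D F (2 * (1 + R)))
    (AdaGradNorm.measurable_distInc hs z D F _)
    (fun w S hS => hκ.lintegral_exp_distInc_le hγ hD0 hR0 rfl hN w hS) hδ hT
  have hP3 := hrun.measure_sum_gt_le (φ := AdaGradNorm.noiseInc f z F (2 * (1 + R)))
    (AdaGradNorm.measurable_noiseInc hs z F _)
    (fun w S hS => hκ.lintegral_exp_noiseInc_le hγ hR0 rfl hN w hS) hδ hT
  have hP4 := hrun.measure_sum_gt_le
    (φ := fun w _ v => AdaGradNorm.regretInc f z σ₀ σ₁ a w v)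
    (AdaGradNorm.measurable_regretInc hs z a)
    (fun w _ _ => hκ.lintegral_exp_regretInc_le a z w) hδ hT
  have hP0 : P {ω | ¬ ∀ t < T, ‖g t ω - ∇ f (AdaGradNorm.iterate η γ w₁ (fun s => g s ω) t)‖ ^ 2 ≤
      AdaGradNorm.noiseSq f σ₀ σ₁ (AdaGradNorm.iterate η γ w₁ (fun s => g s ω) t)} = 0 := by
    refine ae_iff.1 ?_
    rw [ae_all_iff]
    intro t
    by_cases ht : t < T
    · filter_upwards [hrun.ae_of_oracle (p := fun w v => ‖v - ∇ f w‖ ^ 2 ≤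
        AdaGradNorm.noiseSq f σ₀ σ₁ w) (AdaGradNorm.measurableSet_noise hs) hκ.noise ht]
        with ω hω _ using hω
    · exact Filter.Eventually.of_forall fun ω h => absurd h ht
  refine AdaGradNorm.ofReal_one_sub_le_measure hδ.le hP0 hP1 hP2 hP3 hP4
    fun ω h0' h1' h2' h3' h4' => ?_
  simp only [Set.mem_ofPred_eq, not_not, not_exists, not_and, not_lt] at h0' h1' h2' h3' h4'
  exact AdaGradNorm.conclusion_of_sum_le hβ h0 h1 hη hγ hf hs hmin hδ hδ4 hT h0' hc hL hF
    hD0 hD2 hR ha h1' h2' h3' (h4' T le_rfl)
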